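/- Let $n \ge 2$, let $S^{n-1} = \{x \in \mathbb{R}^n : |x| = 1\}$ be the Euclidean unit sphere, and let $\sigma_{n-1}$ be the uniform probability measure (normalized surface measure) on $S^{n-1}$. Let $f : S^{n-1} \to \mathbb{R}$ satisfy $\|f\|_{\mathrm{Lip}} \le 1$ with respect to the geodesic distance, that is, $|f(x) - f(y)| \le \arccos\langle x, y\rangle$ for all $x, y \in S^{n-1}$ (in particular, $f$ may be any function on $S^{n-1}$ that is $1$-Lipschitz for the Euclidean distance $|x-y|$), and let $m = \int_{S^{n-1}} f \, d\sigma_{n-1}$. Then for every $r > 0$, $$\sigma_{n-1}\{x : |f(x) - m| \ge r\} \le \frac{1}{r}\, e^{-(n-2) r^2/2} \int_{S^{n-1}} |f - m| \, d\sigma_{n-1}.$$ -/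

import Mathlib

open MeasureTheory

noncomputable section

/-- The unit sphere `S^{n-1} = {x ∈ ℝⁿ : |x| = 1}`, as a subtype of Euclidean space. -/
abbrev UnitSphere (n : ℕ) : Type :=
  Metric.sphere (0 : EuclideanSpace ℝ (Fin n)) 1

/-- The uniform distribution `σ_{n-1}` on `S^{n-1}`: the surface measure induced by Lebesgue
measure, normalized to total mass one. -/
def sphereUniform (n : ℕ) : Measure (UnitSphere n) :=
  ((volume : Measure (EuclideanSpace ℝ (Fin n))).toSphere Set.univ)⁻¹ •
    (volume : Measure (EuclideanSpace ℝ (Fin n))).toSphere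

/-- The geodesic distance on `S^{n-1}`: the angle `arccos ⟨x, y⟩` between two unit vectors. -/
def geodesicDist {n : ℕ} (x y : UnitSphere n) : ℝ :=
  InnerProductGeometry.angle (x : EuclideanSpace ℝ (Fin n)) (y : EuclideanSpace ℝ (Fin n))

end

open Set Filter Topology
open scoped RealInnerProductSpace Pointwise

namespace SphereConcentration

variable {n : ℕ}

/-! ### Invariance of the uniform measure -/

/-! The engine is the covariance inequality `GeoLip.covariance_le`: if `f` is 1-Lipschitz and `g`
has gradient `a`, then cov(f, g) ≤ (n-2)⁻¹ ∫ |a|. The Ricci curvature n-2 of the sphere enters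
through a random walk instead of the heat semigroup. From `x` the walk jumps to the mirror image of
`x` in a random hyperplane u^⊥ nearly containing `x`. Its normalized operator `K` is reversible, and
by `GeoLip.avg_contraction` it multiplies Lipschitz constants by 1-κ. Telescoping ⟨f, g⟩ - ⟨K^k f,
g⟩ writes the covariance as a sum of Dirichlet forms of K^i f and g. The i-th is at most (1-κ)^i b,
where b is essentially ∫ |a| times the step variance (`GeoLip.local_dirichlet_le`). The geometric
series gives b/κ, which tends to (n-2)⁻¹ ∫ |a| as the step size goes to 0.

For centered `f` and l = n-2, take g = T(f) with T' = s exp(l s²/2) on (0, r) and 0 elsewhere (up to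
smoothing). By Rademacher |∇g| ≤ T'(f), so l ∫ f T(f) ≤ ∫ T'(f). Here l T(s) = exp(l min(s, r)²/2) -
1 for s > 0. The contributions of {0 < f < r} cancel, leaving r exp(l r²/2) σ{f ≥ r} ≤ ∫ max(f, 0).
Adding the same bound for -f turns the right-hand side into ∫ |f|. For n = 2 the claim is Markov's
inequality. -/

/-- The action of a linear isometry on the unit sphere. -/
noncomputable def act (U : EuclideanSpace ℝ (Fin n) ≃ₗᵢ[ℝ] EuclideanSpace ℝ (Fin n)) (x : UnitSphere n) :
    UnitSphere n :=
  ⟨U x, by simp⟩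

@[simp]
lemma coe_act (U : EuclideanSpace ℝ (Fin n) ≃ₗᵢ[ℝ] EuclideanSpace ℝ (Fin n)) (x : UnitSphere n) :
    (act U x : EuclideanSpace ℝ (Fin n)) = U x := rfl

lemma continuous_act (U : EuclideanSpace ℝ (Fin n) ≃ₗᵢ[ℝ] EuclideanSpace ℝ (Fin n)) :
    Continuous (act U) :=
  (U.continuous.comp continuous_subtype_val).subtype_mk _

/-- The action of a linear isometry on the unit sphere, as a measurable equivalence. -/
noncomputable def actEquiv (U : EuclideanSpace ℝ (Fin n) ≃ₗᵢ[ℝ] EuclideanSpace ℝ (Fin n)) :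
    UnitSphere n ≃ᵐ UnitSphere n where
  toFun := act U
  invFun := act U.symm
  left_inv x := by ext1; simp
  right_inv x := by ext1; simp
  measurable_toFun := (continuous_act U).measurable
  measurable_invFun := (continuous_act U.symm).measurable

/-- The surface measure of `s` is a multiple of the volume of the cone (0,1)·s; isometries carry
cones to cones and preserve volume. -/
lemma measurePreserving_act_toSphere
    (U : EuclideanSpace ℝ (Fin n) ≃ₗᵢ[ℝ] EuclideanSpace ℝ (Fin n)) :
    MeasurePreserving (act U) (volume : Measure (EuclideanSpace ℝ (Fin n))).toSphere
      (volume : Measure (EuclideanSpace ℝ (Fin n))).toSphere := by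
  refine ⟨(continuous_act U).measurable, ?_⟩
  ext s hs
  rw [Measure.map_apply (continuous_act U).measurable hs,
    Measure.toSphere_apply' _ ((continuous_act U).measurable hs), Measure.toSphere_apply' _ hs]
  congr 1
  have h : Ioo (0 : ℝ) 1 • ((↑) '' (act U ⁻¹' s) : Set (EuclideanSpace ℝ (Fin n))) =
      U ⁻¹' (Ioo (0 : ℝ) 1 • ((↑) '' s : Set (EuclideanSpace ℝ (Fin n)))) := by
    ext z
    simp only [Set.mem_smul, Set.mem_image, Set.mem_preimage]
    constructor
    · rintro ⟨t, ht, _, ⟨y, hy, rfl⟩, rfl⟩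
      exact ⟨t, ht, U y, ⟨act U y, hy, rfl⟩, by simp⟩
    · rintro ⟨t, ht, _, ⟨y, hy, rfl⟩, h⟩
      refine ⟨t, ht, U.symm y, ⟨act U.symm y, ?_, rfl⟩, ?_⟩
      · have : act U (act U.symm y) = y := by ext1; simp
        rwa [this]
      · apply U.injective
        simpa using h
  rw [h]
  exact U.measurePreserving.measure_preimage_equiv (f := U.toHomeomorph.toMeasurableEquiv) _

lemma measurePreserving_act (U : EuclideanSpace ℝ (Fin n) ≃ₗᵢ[ℝ] EuclideanSpace ℝ (Fin n)) :
    MeasurePreserving (act U) (sphereUniform n) (sphereUniform n) :=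
  (measurePreserving_act_toSphere U).smul_measure _

lemma integral_act (U : EuclideanSpace ℝ (Fin n) ≃ₗᵢ[ℝ] EuclideanSpace ℝ (Fin n))
    (F : UnitSphere n → ℝ) :
    ∫ x, F (act U x) ∂(sphereUniform n) = ∫ x, F x ∂(sphereUniform n) :=
  (measurePreserving_act U).integral_comp (actEquiv U).measurableEmbedding F

lemma toSphere_univ_ne_zero [NeZero n] :
    (volume : Measure (EuclideanSpace ℝ (Fin n))).toSphere univ ≠ 0 := by
  rw [Ne, Measure.measure_univ_eq_zero]
  exact Measure.toSphere_ne_zero _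

instance [NeZero n] : IsProbabilityMeasure (sphereUniform n) :=
  ⟨by
    rw [sphereUniform, Measure.smul_apply, smul_eq_mul]
    exact ENNReal.inv_mul_cancel toSphere_univ_ne_zero (measure_ne_top _ _)⟩

instance [NeZero n] : (sphereUniform n).IsOpenPosMeasure :=
  ⟨fun U hU hne => by
    rw [sphereUniform, Measure.smul_apply, smul_eq_mul]
    exact mul_ne_zero (ENNReal.inv_ne_zero.2 (measure_ne_top _ _)) (hU.measure_ne_zero _ hne)⟩

instance : IsFiniteMeasure (sphereUniform n) := by
  rcases Nat.eq_zero_or_pos n with rfl | h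
  -- For n = 0 the sphere is empty; covering this case frees the integrability lemmas from any
  -- condition on n.
  · have : IsEmpty (UnitSphere 0) := ⟨fun x => by
      have h := x.2
      have h0 : (x : EuclideanSpace ℝ (Fin 0)) = 0 := Subsingleton.elim _ _
      rw [h0] at h
      simp at h⟩
    exact ⟨by simp [Set.univ_eq_empty_iff.2 this]⟩
  · have : NeZero n := ⟨h.ne'⟩
    infer_instance

lemma integrable_of_continuous {F : UnitSphere n → ℝ} (hF : Continuous F) :
    Integrable F (sphereUniform n) := by
  have := hF.continuousOn.integrableOn_compact (μ := sphereUniform n) isCompact_univ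
  rwa [integrableOn_univ] at this

lemma norm_coe (x : UnitSphere n) : ‖(x : EuclideanSpace ℝ (Fin n))‖ = 1 := by simp

lemma inner_self (x : UnitSphere n) : ⟪(x : EuclideanSpace ℝ (Fin n)), x⟫ = 1 := by
  simp

/-! ### Reflections -/

/-- The orthogonal reflection in the hyperplane orthogonal to a vector. -/
noncomputable def refl (u : EuclideanSpace ℝ (Fin n)) :
    EuclideanSpace ℝ (Fin n) ≃ₗᵢ[ℝ] EuclideanSpace ℝ (Fin n) :=
  (ℝ ∙ u)ᗮ.reflection

lemma refl_apply {u : EuclideanSpace ℝ (Fin n)} (hu : ‖u‖ = 1) (x : EuclideanSpace ℝ (Fin n)) :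
    refl u x = x - (2 * ⟪u, x⟫) • u := by
  rw [refl, Submodule.reflection_orthogonal_apply, Submodule.reflection_singleton_apply]
  simp [hu, mul_smul, two_smul]

/-- The image of `x` under the reflection in the hyperplane orthogonal to `u`. -/
noncomputable def step (x u : UnitSphere n) : UnitSphere n := act (refl (u : EuclideanSpace ℝ (Fin n))) x

lemma coe_step (x u : UnitSphere n) :
    (step x u : EuclideanSpace ℝ (Fin n)) =
      x - (2 * ⟪(u : EuclideanSpace ℝ (Fin n)), x⟫) • (u : EuclideanSpace ℝ (Fin n)) :=
  refl_apply (norm_coe u) _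

/-- Conjugating the reflection along u by U gives the reflection along U u, so the walk commutes
with isometries. -/
lemma act_step (U : EuclideanSpace ℝ (Fin n) ≃ₗᵢ[ℝ] EuclideanSpace ℝ (Fin n))
    (x u : UnitSphere n) : act U (step x u) = step (act U x) (act U u) := by
  ext1
  simp only [coe_act, coe_step, map_sub, map_smul, U.inner_map_map]

lemma step_step (x u : UnitSphere n) : step (step x u) u = x := by
  ext1
  rw [coe_step, coe_step]
  simp only [inner_sub_right, inner_smul_right, inner_self]
  module

lemma inner_step (x u : UnitSphere n) :
    ⟪(u : EuclideanSpace ℝ (Fin n)), step x u⟫ = -⟪(u : EuclideanSpace ℝ (Fin n)), x⟫ := by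
  rw [coe_step]
  simp only [inner_sub_right, inner_smul_right, inner_self]
  ring

lemma norm_step_sub (x u : UnitSphere n) :
    ‖(step x u : EuclideanSpace ℝ (Fin n)) - x‖ = 2 * |⟪(u : EuclideanSpace ℝ (Fin n)), x⟫| := by
  rw [coe_step, sub_sub_cancel_left, norm_neg, norm_smul, norm_coe]
  simp

@[fun_prop]
lemma continuous_step : Continuous fun p : UnitSphere n × UnitSphere n => step p.1 p.2 := by
  rw [Topology.IsInducing.subtypeVal.continuous_iff]
  have : (Subtype.val ∘ fun p : UnitSphere n × UnitSphere n => step p.1 p.2) =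
      fun p => (p.1 : EuclideanSpace ℝ (Fin n)) -
        (2 * ⟪(p.2 : EuclideanSpace ℝ (Fin n)), p.1⟫) • (p.2 : EuclideanSpace ℝ (Fin n)) := by
    ext1 p
    exact coe_step p.1 p.2
  rw [this]
  fun_prop

lemma continuous_step_left (u : UnitSphere n) : Continuous fun x => step x u :=
  continuous_act _

lemma step_eq_act (x u : UnitSphere n) :
    step x u = act (refl (u : EuclideanSpace ℝ (Fin n))) x := rfl

attribute [irreducible] step

lemma continuous_step_right (x : UnitSphere n) :
    Continuous fun u : UnitSphere n => step x u :=
  continuous_step.comp (by fun_prop : Continuous fun u : UnitSphere n => (x, u))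

/-- The reflection in the hyperplane bisecting x and y works; it is the identity if x = y. -/
lemma exists_act_eq (x y : UnitSphere n) :
    ∃ U : EuclideanSpace ℝ (Fin n) ≃ₗᵢ[ℝ] EuclideanSpace ℝ (Fin n), act U x = y :=
  ⟨(ℝ ∙ ((x : EuclideanSpace ℝ (Fin n)) - y))ᗮ.reflection,
    Subtype.ext (Submodule.reflection_sub (by simp))⟩

/-! ### Moments of the uniform measure -/

lemma exists_unit_orthogonal (hn : 2 ≤ n) (x : UnitSphere n) :
    ∃ e : UnitSphere n, ⟪(e : EuclideanSpace ℝ (Fin n)), x⟫ = 0 := by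
  have hne : (ℝ ∙ (x : EuclideanSpace ℝ (Fin n)))ᗮ ≠ ⊥ := by
    intro h
    have h1 := Submodule.finrank_add_finrank_orthogonal (ℝ ∙ (x : EuclideanSpace ℝ (Fin n)))
    have h2 := finrank_span_singleton (K := ℝ) (v := (x : EuclideanSpace ℝ (Fin n)))
      (by intro h; have := norm_coe x; simp [h] at this)
    rw [h, h2] at h1
    simp at h1
    omega
  obtain ⟨e, he, he0⟩ := Submodule.exists_mem_ne_zero_of_ne_bot hne
  refine ⟨⟨‖e‖⁻¹ • e, by simp [norm_smul, he0]⟩, ?_⟩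
  rw [Submodule.mem_orthogonal_singleton_iff_inner_left] at he
  simp [inner_smul_left, he]

/-- Transitivity of the isometry group. It makes the total mass Z and the step variance D
independent of the base point. -/
lemma integral_inner_eq (φ : ℝ → ℝ) (x y : UnitSphere n) :
    ∫ u, φ ⟪(u : EuclideanSpace ℝ (Fin n)), x⟫ ∂(sphereUniform n) =
      ∫ u, φ ⟪(u : EuclideanSpace ℝ (Fin n)), y⟫ ∂(sphereUniform n) := by
  obtain ⟨U, rfl⟩ := exists_act_eq x y
  rw [← integral_act U (fun u => φ ⟪(u : EuclideanSpace ℝ (Fin n)), act U x⟫)]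
  simp

lemma refl_sub_fixes {x e e' : EuclideanSpace ℝ (Fin n)} (he : ⟪e, x⟫ = 0) (he' : ⟪e', x⟫ = 0) :
    (ℝ ∙ (e - e'))ᗮ.reflection x = x := by
  rw [Submodule.reflection_eq_self_iff, Submodule.mem_orthogonal_singleton_iff_inner_right,
    inner_sub_left, he, he', sub_zero]

/-- The reflection swapping e and e' fixes x, because both are orthogonal to x. -/
lemma integral_inner_sq_eq (φ : ℝ → ℝ) (x e e' : UnitSphere n)
    (he : ⟪(e : EuclideanSpace ℝ (Fin n)), x⟫ = 0) (he' : ⟪(e' : EuclideanSpace ℝ (Fin n)), x⟫ = 0) :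
    ∫ u, φ ⟪(u : EuclideanSpace ℝ (Fin n)), x⟫ * ⟪(u : EuclideanSpace ℝ (Fin n)), e⟫ ^ 2
        ∂(sphereUniform n) =
      ∫ u, φ ⟪(u : EuclideanSpace ℝ (Fin n)), x⟫ * ⟪(u : EuclideanSpace ℝ (Fin n)), e'⟫ ^ 2
        ∂(sphereUniform n) := by
  set U := (ℝ ∙ ((e : EuclideanSpace ℝ (Fin n)) - e'))ᗮ.reflection with hU
  have hx : U x = x := refl_sub_fixes he he'
  have hUe : U e = e' := Submodule.reflection_sub (by simp)
  rw [← integral_act U (fun u => φ ⟪(u : EuclideanSpace ℝ (Fin n)), x⟫ *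
    ⟪(u : EuclideanSpace ℝ (Fin n)), e'⟫ ^ 2)]
  congr 1
  ext u
  have h1 : ⟪U u, x⟫ = ⟪(u : EuclideanSpace ℝ (Fin n)), x⟫ := by
    rw [← U.inner_map_map (u : EuclideanSpace ℝ (Fin n)) x, hx]
  rw [coe_act, h1, ← hUe, U.inner_map_map]

/-- The components of a rotation invariant weight orthogonal to its axis have equal second
moments. -/
lemma integral_inner_sq {φ : ℝ → ℝ} (hφ : Continuous φ) (x e : UnitSphere n)
    (he : ⟪(e : EuclideanSpace ℝ (Fin n)), x⟫ = 0) :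
    ((n : ℝ) - 1) * ∫ u, φ ⟪(u : EuclideanSpace ℝ (Fin n)), x⟫ *
        ⟪(u : EuclideanSpace ℝ (Fin n)), e⟫ ^ 2 ∂(sphereUniform n) =
      ∫ u, φ ⟪(u : EuclideanSpace ℝ (Fin n)), x⟫ *
        (1 - ⟪(u : EuclideanSpace ℝ (Fin n)), x⟫ ^ 2) ∂(sphereUniform n) := by
  set V := (ℝ ∙ (x : EuclideanSpace ℝ (Fin n)))ᗮ with hV
  have hdim : (Module.finrank ℝ V : ℝ) = n - 1 := by
    have h1 := Submodule.finrank_add_finrank_orthogonal (ℝ ∙ (x : EuclideanSpace ℝ (Fin n)))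
    have h2 := finrank_span_singleton (K := ℝ) (v := (x : EuclideanSpace ℝ (Fin n)))
      (by intro h; have := norm_coe x; simp [h] at this)
    rw [h2, finrank_euclideanSpace, Fintype.card_fin] at h1
    rw [eq_sub_iff_add_eq, add_comm]
    exact_mod_cast h1
  set b := stdOrthonormalBasis ℝ V with hb
  have hbo : ∀ i, ⟪((b i : V) : EuclideanSpace ℝ (Fin n)), x⟫ = 0 := fun i =>
    Submodule.mem_orthogonal_singleton_iff_inner_left.1 (b i).2
  have hbn : ∀ i, ‖((b i : V) : EuclideanSpace ℝ (Fin n))‖ = 1 := b.orthonormal.1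
  -- Pythagoras in x^⊥: the squared coordinates of the projection of u add up to its squared length.
  -- By symmetry each contributes equally.
  have hsum : ∀ u : UnitSphere n, ∑ i, ⟪(u : EuclideanSpace ℝ (Fin n)), (b i : V)⟫ ^ 2 =
      1 - ⟪(u : EuclideanSpace ℝ (Fin n)), x⟫ ^ 2 := by
    intro u
    have hp : (u : EuclideanSpace ℝ (Fin n)) -
        ⟪(u : EuclideanSpace ℝ (Fin n)), x⟫ • (x : EuclideanSpace ℝ (Fin n)) ∈ V := by
      rw [hV, Submodule.mem_orthogonal_singleton_iff_inner_left]
      simp only [inner_sub_left, inner_smul_left, inner_self]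
      simp
    have h2 := b.sum_sq_inner_right ⟨_, hp⟩
    rw [Submodule.coe_norm, norm_sub_sq_real, norm_smul, norm_coe, norm_coe, inner_smul_right,
      Real.norm_eq_abs, mul_one, sq_abs] at h2
    have h3 : ∀ i, ⟪(u : EuclideanSpace ℝ (Fin n)), (b i : V)⟫ = ⟪b i, ⟨_, hp⟩⟫ := fun i => by
      rw [Submodule.coe_inner, inner_sub_right, inner_smul_right, hbo, real_inner_comm]
      simp
    simp_rw [h3]
    rw [h2]
    ring
  have hE : ∀ i, ∫ u, φ ⟪(u : EuclideanSpace ℝ (Fin n)), x⟫ *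
        ⟪(u : EuclideanSpace ℝ (Fin n)), (b i : V)⟫ ^ 2 ∂(sphereUniform n) =
      ∫ u, φ ⟪(u : EuclideanSpace ℝ (Fin n)), x⟫ *
        ⟪(u : EuclideanSpace ℝ (Fin n)), e⟫ ^ 2 ∂(sphereUniform n) := fun i =>
    integral_inner_sq_eq φ x ⟨(b i : V), by simp [hbn]⟩ e (hbo i) he
  calc _ = ∑ i : Fin (Module.finrank ℝ V), ∫ u, φ ⟪(u : EuclideanSpace ℝ (Fin n)), x⟫ *
        ⟪(u : EuclideanSpace ℝ (Fin n)), (b i : V)⟫ ^ 2 ∂(sphereUniform n) := by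
        simp_rw [hE]
        simp [← hdim]
    _ = ∫ u, ∑ i : Fin (Module.finrank ℝ V), φ ⟪(u : EuclideanSpace ℝ (Fin n)), x⟫ *
        ⟪(u : EuclideanSpace ℝ (Fin n)), (b i : V)⟫ ^ 2 ∂(sphereUniform n) := by
        rw [integral_finsetSum]
        intro i _
        exact integrable_of_continuous (by fun_prop)
    _ = _ := by simp_rw [← Finset.mul_sum, hsum]

/-! ### The geodesic distance -/

lemma geodesicDist_eq_arccos (x y : UnitSphere n) :
    geodesicDist x y = Real.arccos ⟪(x : EuclideanSpace ℝ (Fin n)), y⟫ := by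
  simp [geodesicDist, InnerProductGeometry.angle]

lemma geodesicDist_nonneg (x y : UnitSphere n) : 0 ≤ geodesicDist x y :=
  InnerProductGeometry.angle_nonneg _ _

lemma geodesicDist_le_pi (x y : UnitSphere n) : geodesicDist x y ≤ Real.pi :=
  InnerProductGeometry.angle_le_pi _ _

lemma cos_geodesicDist (x y : UnitSphere n) :
    Real.cos (geodesicDist x y) = ⟪(x : EuclideanSpace ℝ (Fin n)), y⟫ := by
  rw [geodesicDist, InnerProductGeometry.cos_angle]
  simp

lemma geodesicDist_le_of_cos_le {x y : UnitSphere n} {a : ℝ} (h0 : 0 ≤ a) (hpi : a ≤ Real.pi)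
    (h : Real.cos a ≤ ⟪(x : EuclideanSpace ℝ (Fin n)), y⟫) : geodesicDist x y ≤ a := by
  rw [geodesicDist_eq_arccos, ← Real.arccos_cos h0 hpi]
  exact Real.arccos_le_arccos h

lemma norm_sub_eq_sin (x y : UnitSphere n) :
    ‖(x : EuclideanSpace ℝ (Fin n)) - y‖ = 2 * Real.sin (geodesicDist x y / 2) := by
  have h1 : 0 ≤ Real.sin (geodesicDist x y / 2) :=
    Real.sin_nonneg_of_nonneg_of_le_pi (by linarith [geodesicDist_nonneg x y])
      (by linarith [geodesicDist_le_pi x y, Real.pi_pos])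
  rw [← sq_eq_sq₀ (norm_nonneg _) (by positivity), norm_sub_sq_real, norm_coe, norm_coe,
    ← cos_geodesicDist, mul_pow, Real.sin_sq_eq_half_sub]
  ring_nf

lemma geodesicDist_le_pi_half_mul (x y : UnitSphere n) :
    geodesicDist x y ≤ Real.pi / 2 * ‖(x : EuclideanSpace ℝ (Fin n)) - y‖ := by
  rw [norm_sub_eq_sin]
  have h := Real.mul_le_sin (x := geodesicDist x y / 2) (by linarith [geodesicDist_nonneg x y])
    (by linarith [geodesicDist_le_pi x y])
  have hpi := Real.pi_pos
  calc geodesicDist x y = Real.pi * (2 / Real.pi * (geodesicDist x y / 2)) := by field_simp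
    _ ≤ Real.pi * Real.sin (geodesicDist x y / 2) := by gcongr
    _ = _ := by ring

/-- Short chords are almost as long as the arcs they span. -/
lemma geodesicDist_mul_le_of_norm_le {ε : ℝ} (hε : ε ≤ 1 / 4) {x y : UnitSphere n}
    (h : ‖(x : EuclideanSpace ℝ (Fin n)) - y‖ ≤ 4 * ε) :
    (1 - ε) * geodesicDist x y ≤ ‖(x : EuclideanSpace ℝ (Fin n)) - y‖ := by
  rcases (geodesicDist_nonneg x y).eq_or_lt with h0 | h0
  · rw [← h0]; simp
  have hpi := Real.pi_pos
  have hpi4 := Real.pi_lt_d2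
  have hε0 : 0 ≤ ε := by linarith [norm_nonneg ((x : EuclideanSpace ℝ (Fin n)) - y)]
  have h1 := geodesicDist_le_pi_half_mul x y
  set z := geodesicDist x y / 2 with hz
  -- As ε ≤ 1/4, the half-angle z ≤ πε satisfies z²/4 ≤ (π²/16) · 4ε²·(1/ε)·(1/1) ≤ ε·1, which
  -- absorbs the cubic Taylor error of sin z.
  have hzε : z ≤ Real.pi * ε := by nlinarith
  have hz1 : z ≤ 1 := by nlinarith
  have hs := Real.sin_gt_sub_cube (x := z) (by linarith)
  rw [norm_sub_eq_sin, ← hz]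
  have hz2 : z ^ 2 / 4 ≤ ε := by nlinarith
  have hz0 : 0 ≤ z := by linarith
  have : z ^ 3 / 6 ≤ ε * z := by
    calc z ^ 3 / 6 ≤ z ^ 2 / 4 * z := by linarith [pow_nonneg hz0 3, pow_succ z 2]
      _ ≤ ε * z := by gcongr
  nlinarith

/-! ### Functions that are Lipschitz for the geodesic distance -/

/-- `h` is Lipschitz with constant `L` for the geodesic distance. -/
def GeoLip (L : ℝ) (h : UnitSphere n → ℝ) : Prop :=
  ∀ x y, |h x - h y| ≤ L * geodesicDist x y

lemma GeoLip.continuous {L : ℝ} {h : UnitSphere n → ℝ} (hh : GeoLip L h) : Continuous h := by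
  have : LipschitzWith (Real.toNNReal (|L| * (Real.pi / 2))) h := by
    refine LipschitzWith.of_dist_le_mul fun x y => ?_
    rw [Real.coe_toNNReal _ (by positivity), Real.dist_eq, Subtype.dist_eq, dist_eq_norm]
    calc |h x - h y| ≤ L * geodesicDist x y := hh x y
      _ ≤ |L| * (Real.pi / 2 * ‖(x : EuclideanSpace ℝ (Fin n)) - y‖) := by
        gcongr
        · exact geodesicDist_nonneg _ _
        · exact le_abs_self L
        · exact geodesicDist_le_pi_half_mul x y
      _ = _ := by ring
  exact this.continuous

/-- Gram–Schmidt applied to y against x. If y = ±x the sine vanishes and any unit vector orthogonal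
to x serves, hence n ≥ 2. -/
lemma exists_polar (hn : 2 ≤ n) (x y : UnitSphere n) :
    ∃ e : UnitSphere n, ⟪(e : EuclideanSpace ℝ (Fin n)), x⟫ = 0 ∧
      (y : EuclideanSpace ℝ (Fin n)) =
        Real.cos (geodesicDist x y) • (x : EuclideanSpace ℝ (Fin n)) +
          Real.sin (geodesicDist x y) • (e : EuclideanSpace ℝ (Fin n)) := by
  set c := Real.cos (geodesicDist x y) with hc
  set s := Real.sin (geodesicDist x y) with hs
  have hs0 : 0 ≤ s :=
    Real.sin_nonneg_of_nonneg_of_le_pi (geodesicDist_nonneg x y) (geodesicDist_le_pi x y)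
  set v : EuclideanSpace ℝ (Fin n) := y - c • (x : EuclideanSpace ℝ (Fin n)) with hv
  have hxy : ⟪(y : EuclideanSpace ℝ (Fin n)), x⟫ = c := by
    rw [real_inner_comm, hc, cos_geodesicDist]
  have hvn : ‖v‖ = s := by
    rw [← sq_eq_sq₀ (norm_nonneg _) hs0, hv, norm_sub_sq_real, inner_smul_right, hxy, norm_smul,
      norm_coe, norm_coe, hs, Real.sin_sq, ← hc, Real.norm_eq_abs, mul_one, sq_abs]
    ring
  have hvx : ⟪v, x⟫ = 0 := by
    rw [hv, inner_sub_left, inner_smul_left, hxy, inner_self]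
    simp
  rcases hs0.eq_or_lt with h | h
  · obtain ⟨e, he⟩ := exists_unit_orthogonal hn x
    refine ⟨e, he, ?_⟩
    rw [← h] at hvn ⊢
    rw [norm_eq_zero, hv, sub_eq_zero] at hvn
    simpa using hvn
  · refine ⟨⟨s⁻¹ • v, by simp [norm_smul, hvn, abs_of_pos h, h.ne']⟩, ?_, ?_⟩
    · simp [inner_smul_left, hvx]
    · simp [smul_smul, h.ne', hv]

/-- The rotation in the plane of two orthonormal vectors moving `x` to `y`, and the distance by
which it moves an arbitrary point. -/
lemma exists_rotation (hn : 2 ≤ n) (x y : UnitSphere n) :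
    ∃ U : EuclideanSpace ℝ (Fin n) ≃ₗᵢ[ℝ] EuclideanSpace ℝ (Fin n), ∃ e : UnitSphere n,
      ⟪(e : EuclideanSpace ℝ (Fin n)), x⟫ = 0 ∧ act U x = y ∧
      ∀ z : UnitSphere n, geodesicDist z (act U z) ≤ geodesicDist x y *
        ((1 + (⟪(z : EuclideanSpace ℝ (Fin n)), x⟫ ^ 2 +
          ⟪(z : EuclideanSpace ℝ (Fin n)), e⟫ ^ 2)) / 2) := by
  obtain ⟨e, he, hy⟩ := exists_polar hn x y
  set θ := geodesicDist x y with hθ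
  have hθ0 : 0 ≤ θ := geodesicDist_nonneg x y
  have hθpi : θ ≤ Real.pi := geodesicDist_le_pi x y
  set C := Real.cos (θ / 2) with hC
  set S := Real.sin (θ / 2) with hS
  have hCS : C ^ 2 + S ^ 2 = 1 := Real.cos_sq_add_sin_sq _
  have hS0 : 0 ≤ S := Real.sin_nonneg_of_nonneg_of_le_pi (by linarith) (by linarith)
  -- v is the midpoint of the arc from x to y. Reflecting along x and then along v rotates the plane
  -- of x and e by θ, twice the angle between x and v.
  set v : EuclideanSpace ℝ (Fin n) := C • (x : EuclideanSpace ℝ (Fin n)) + S • e with hv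
  have hxe : ⟪(x : EuclideanSpace ℝ (Fin n)), e⟫ = 0 := by rw [real_inner_comm, he]
  have hvn : ‖v‖ = 1 := by
    rw [← sq_eq_sq₀ (norm_nonneg _) one_pos.le, hv, norm_add_sq_real, norm_smul, norm_smul,
      norm_coe, norm_coe, inner_smul_left, inner_smul_right, hxe]
    simp [hCS]
  have hU : ∀ z : EuclideanSpace ℝ (Fin n), refl v (refl x z) = z -
      (2 * S ^ 2 * ⟪(x : EuclideanSpace ℝ (Fin n)), z⟫ + 2 * S * C * ⟪(e : EuclideanSpace ℝ (Fin n)), z⟫) •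
        (x : EuclideanSpace ℝ (Fin n)) +
      (2 * S * C * ⟪(x : EuclideanSpace ℝ (Fin n)), z⟫ - 2 * S ^ 2 * ⟪(e : EuclideanSpace ℝ (Fin n)), z⟫) •
        (e : EuclideanSpace ℝ (Fin n)) := by
    intro z
    rw [refl_apply hvn, refl_apply (norm_coe x), hv]
    simp only [inner_sub_right, inner_smul_right, inner_add_left, inner_smul_left, inner_self,
      he]
    simp only [conj_trivial, mul_zero, add_zero, mul_one]
    have hC2 : C ^ 2 = 1 - S ^ 2 := by linarith
    match_scalars
    · ring
    · linear_combination (2 * ⟪(x : EuclideanSpace ℝ (Fin n)), z⟫) * hC2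
    · ring
  refine ⟨(refl x).trans (refl v), e, he, ?_, ?_⟩
  · ext1
    rw [coe_act, LinearIsometryEquiv.trans_apply, hU, hy, inner_self, he]
    have h1 : Real.cos θ = C ^ 2 - S ^ 2 := by
      rw [hC, hS, ← Real.cos_two_mul']; ring_nf
    have h2 : Real.sin θ = 2 * S * C := by
      rw [hC, hS, ← Real.sin_two_mul]; ring_nf
    rw [h1, h2]
    match_scalars
    · linear_combination (-1 : ℝ) * hCS
    · ring
  · intro z
    set a := ⟪(z : EuclideanSpace ℝ (Fin n)), x⟫ with ha
    set b := ⟪(z : EuclideanSpace ℝ (Fin n)), e⟫ with hb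
    have ha' : ⟪(x : EuclideanSpace ℝ (Fin n)), z⟫ = a := real_inner_comm _ _
    have hb' : ⟪(e : EuclideanSpace ℝ (Fin n)), z⟫ = b := real_inner_comm _ _
    have hP1 : a ^ 2 + b ^ 2 ≤ 1 := by
      have h := sq_nonneg ‖(z : EuclideanSpace ℝ (Fin n)) - (a • (x : EuclideanSpace ℝ (Fin n)) +
        b • (e : EuclideanSpace ℝ (Fin n)))‖
      rw [norm_sub_sq_real, norm_add_sq_real] at h
      simp only [norm_smul, norm_coe, inner_add_right, inner_smul_left, inner_smul_right, hxe,
        ← ha, ← hb, Real.norm_eq_abs, mul_one, sq_abs] at h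
      simp only [conj_trivial] at h
      nlinarith
    set P := a ^ 2 + b ^ 2 with hP
    have hP0 : 0 ≤ P := by positivity
    have hq0 : 0 ≤ (1 + P) / 2 := by positivity
    have hq1 : (1 + P) / 2 ≤ 1 := by linarith
    -- The chord from z to U z has half-length S√P. The bound √P ≤ (1+P)/2 with concavity of sine
    -- turns this into an arc bound that is quadratic in z, so that it can be averaged exactly.
    refine geodesicDist_le_of_cos_le (by positivity) (by nlinarith) ?_
    have hinner : ⟪(z : EuclideanSpace ℝ (Fin n)), act ((refl x).trans (refl v)) z⟫ =
        1 - 2 * S ^ 2 * P := by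
      rw [coe_act, LinearIsometryEquiv.trans_apply, hU]
      simp only [inner_sub_right, inner_add_right, inner_smul_right, inner_self, ha', hb', ← ha,
        ← hb, hP]
      ring
    rw [hinner]
    have hcos : Real.cos (θ * ((1 + P) / 2)) =
        1 - 2 * Real.sin ((1 + P) / 2 * (θ / 2)) ^ 2 := by
      have := Real.cos_sq' ((1 + P) / 2 * (θ / 2))
      rw [show θ * ((1 + P) / 2) = 2 * ((1 + P) / 2 * (θ / 2)) by ring, Real.cos_two_mul, this]
      ring
    rw [hcos]
    have hsin : (1 + P) / 2 * S ≤ Real.sin ((1 + P) / 2 * (θ / 2)) := by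
      have := (strictConcaveOn_sin_Icc.concaveOn).2
        (show (0 : ℝ) ∈ Icc 0 Real.pi from ⟨le_rfl, Real.pi_pos.le⟩)
        (show θ / 2 ∈ Icc 0 Real.pi from ⟨by linarith, by linarith⟩)
        (show 0 ≤ 1 - (1 + P) / 2 by linarith) hq0 (by ring)
      simpa using this
    have h1 : ((1 + P) / 2 * S) ^ 2 ≤ Real.sin ((1 + P) / 2 * (θ / 2)) ^ 2 :=
      pow_le_pow_left₀ (by positivity) hsin 2
    have h2 : S ^ 2 * P ≤ ((1 + P) / 2 * S) ^ 2 := by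
      have : P ≤ ((1 + P) / 2) ^ 2 := by nlinarith [sq_nonneg (1 - P)]
      calc S ^ 2 * P ≤ S ^ 2 * ((1 + P) / 2) ^ 2 := by gcongr
        _ = _ := by ring
    linarith

/-! ### The random walk of small reflections -/

/-- The unnormalized transition operator of the walk that reflects `x` in a random hyperplane,
chosen with a weight depending on its distance to `x`. -/
noncomputable def avg (w : ℝ → ℝ) (h : UnitSphere n → ℝ) (x : UnitSphere n) : ℝ :=
  ∫ u, w ⟪(u : EuclideanSpace ℝ (Fin n)), x⟫ * h (step x u) ∂(sphereUniform n)

lemma integrable_avg {w : ℝ → ℝ} (hw : Continuous w) {h : UnitSphere n → ℝ} (hh : Continuous h)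
    (x : UnitSphere n) :
    Integrable (fun u : UnitSphere n => w ⟪(u : EuclideanSpace ℝ (Fin n)), x⟫ * h (step x u))
      (sphereUniform n) :=
  integrable_of_continuous <|
    (hw.comp (by fun_prop)).mul (hh.comp (continuous_step_right x))

lemma avg_act {w : ℝ → ℝ} (h : UnitSphere n → ℝ)
    (U : EuclideanSpace ℝ (Fin n) ≃ₗᵢ[ℝ] EuclideanSpace ℝ (Fin n)) (x : UnitSphere n) :
    avg w h (act U x) = avg w (fun y => h (act U y)) x := by
  rw [avg, avg, ← integral_act U]
  simp only [coe_act, U.inner_map_map, act_step]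

/-! ### Curvature: contraction by coupling -/

/-- Contraction of Lipschitz constants, that is, positive Ricci curvature of the sphere. -/
lemma GeoLip.avg_contraction (hn : 2 ≤ n) {w : ℝ → ℝ} (hw : Continuous w) (hw0 : ∀ t, 0 ≤ w t) {Z D : ℝ}
    (hZ : ∀ x : UnitSphere n,
      ∫ u, w ⟪(u : EuclideanSpace ℝ (Fin n)), x⟫ ∂(sphereUniform n) = Z)
    (hD : ∀ x : UnitSphere n, ∫ u, w ⟪(u : EuclideanSpace ℝ (Fin n)), x⟫ *
      (4 * ⟪(u : EuclideanSpace ℝ (Fin n)), x⟫ ^ 2 *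
        (1 - ⟪(u : EuclideanSpace ℝ (Fin n)), x⟫ ^ 2)) ∂(sphereUniform n) = D)
    {L : ℝ} (hL : 0 ≤ L) {h : UnitSphere n → ℝ} (hh : GeoLip L h) :
    GeoLip (L * (Z - (n - 2) / (2 * (n - 1)) * D)) (avg w h) := by
  intro x y
  obtain ⟨U, e, he, hxy, hU⟩ := exists_rotation hn x y
  have hc := hh.continuous
  have hn1 : (0 : ℝ) < n - 1 := by
    have : (2 : ℝ) ≤ n := by exact_mod_cast hn
    linarith
  have hJ := integral_inner_sq (φ := fun t => w t * (4 * t ^ 2)) (by fun_prop) x e he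
  have hwc : Continuous fun u : UnitSphere n => w ⟪(u : EuclideanSpace ℝ (Fin n)), x⟫ :=
    hw.comp (by fun_prop)
  set θ := geodesicDist x y
  -- Couple the walk from x with its image under U, a walk from y. With t = ⟨u, x⟩ and b = ⟨u, e⟩,
  -- the point reached from x has P = (1-2t²)² + 4t²b², so (1+P)/2 = 1 - (4t²(1-t²) - 4t²b²)/2.
  have hpt : ∀ u : UnitSphere n,
      w ⟪(u : EuclideanSpace ℝ (Fin n)), x⟫ * h (step x u) -
        w ⟪(u : EuclideanSpace ℝ (Fin n)), x⟫ * h (act U (step x u)) ∈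
      Icc (-(L * θ * (w ⟪(u : EuclideanSpace ℝ (Fin n)), x⟫ - (1 / 2) *
          (w ⟪(u : EuclideanSpace ℝ (Fin n)), x⟫ * (4 * ⟪(u : EuclideanSpace ℝ (Fin n)), x⟫ ^ 2 *
            (1 - ⟪(u : EuclideanSpace ℝ (Fin n)), x⟫ ^ 2)) -
          w ⟪(u : EuclideanSpace ℝ (Fin n)), x⟫ * (4 * ⟪(u : EuclideanSpace ℝ (Fin n)), x⟫ ^ 2) *
            ⟪(u : EuclideanSpace ℝ (Fin n)), e⟫ ^ 2))))
        (L * θ * (w ⟪(u : EuclideanSpace ℝ (Fin n)), x⟫ - (1 / 2) *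
          (w ⟪(u : EuclideanSpace ℝ (Fin n)), x⟫ * (4 * ⟪(u : EuclideanSpace ℝ (Fin n)), x⟫ ^ 2 *
            (1 - ⟪(u : EuclideanSpace ℝ (Fin n)), x⟫ ^ 2)) -
          w ⟪(u : EuclideanSpace ℝ (Fin n)), x⟫ * (4 * ⟪(u : EuclideanSpace ℝ (Fin n)), x⟫ ^ 2) *
            ⟪(u : EuclideanSpace ℝ (Fin n)), e⟫ ^ 2))) := by
    intro u
    rw [mem_Icc, ← abs_le, ← mul_sub, abs_mul, abs_of_nonneg (hw0 _)]
    have h1 := (hh (step x u) (act U (step x u))).trans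
      (mul_le_mul_of_nonneg_left (hU (step x u)) hL)
    have h2 : ⟪(step x u : EuclideanSpace ℝ (Fin n)), x⟫ =
        1 - 2 * ⟪(u : EuclideanSpace ℝ (Fin n)), x⟫ ^ 2 := by
      rw [coe_step, inner_sub_left, inner_smul_left, inner_self]
      simp only [conj_trivial]
      ring
    have h3 : ⟪(step x u : EuclideanSpace ℝ (Fin n)), e⟫ =
        -(2 * ⟪(u : EuclideanSpace ℝ (Fin n)), x⟫ * ⟪(u : EuclideanSpace ℝ (Fin n)), e⟫) := by
      rw [coe_step, inner_sub_left, inner_smul_left, real_inner_comm, he]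
      simp only [conj_trivial]
      ring
    rw [h2, h3] at h1
    refine (mul_le_mul_of_nonneg_left h1 (hw0 _)).trans (le_of_eq ?_)
    ring
  have hi1 := integrable_avg hw hc x
  have hi2 : Integrable (fun u : UnitSphere n =>
      w ⟪(u : EuclideanSpace ℝ (Fin n)), x⟫ * h (act U (step x u))) (sphereUniform n) :=
    integrable_avg hw (hc.comp (continuous_act U)) x
  have hbd : Integrable (fun u : UnitSphere n =>
      L * θ * (w ⟪(u : EuclideanSpace ℝ (Fin n)), x⟫ - (1 / 2) *
          (w ⟪(u : EuclideanSpace ℝ (Fin n)), x⟫ * (4 * ⟪(u : EuclideanSpace ℝ (Fin n)), x⟫ ^ 2 *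
            (1 - ⟪(u : EuclideanSpace ℝ (Fin n)), x⟫ ^ 2)) -
          w ⟪(u : EuclideanSpace ℝ (Fin n)), x⟫ * (4 * ⟪(u : EuclideanSpace ℝ (Fin n)), x⟫ ^ 2) *
            ⟪(u : EuclideanSpace ℝ (Fin n)), e⟫ ^ 2))) (sphereUniform n) :=
    integrable_of_continuous (by fun_prop)
  have hval : ∫ u : UnitSphere n,
      L * θ * (w ⟪(u : EuclideanSpace ℝ (Fin n)), x⟫ - (1 / 2) *
          (w ⟪(u : EuclideanSpace ℝ (Fin n)), x⟫ * (4 * ⟪(u : EuclideanSpace ℝ (Fin n)), x⟫ ^ 2 *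
            (1 - ⟪(u : EuclideanSpace ℝ (Fin n)), x⟫ ^ 2)) -
          w ⟪(u : EuclideanSpace ℝ (Fin n)), x⟫ * (4 * ⟪(u : EuclideanSpace ℝ (Fin n)), x⟫ ^ 2) *
            ⟪(u : EuclideanSpace ℝ (Fin n)), e⟫ ^ 2)) ∂(sphereUniform n) =
      L * (Z - (n - 2) / (2 * (n - 1)) * D) * θ := by
    rw [integral_const_mul, integral_sub (integrable_of_continuous (by fun_prop))
      (integrable_of_continuous (by fun_prop)), integral_const_mul,
      integral_sub (integrable_of_continuous (by fun_prop))
      (integrable_of_continuous (by fun_prop)), hZ, hD]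
    -- By `hJ` the b² term averages to D/(n-1), so the net gain is (D - D/(n-1))/2 =
    -- (n-2)D/(2(n-1)).
    simp only [mul_assoc] at hJ hD ⊢
    rw [hD] at hJ
    rw [← hJ]
    field_simp
    ring_nf
  have hdiff : avg w h x - avg w h y =
      ∫ u : UnitSphere n, (w ⟪(u : EuclideanSpace ℝ (Fin n)), x⟫ * h (step x u) -
        w ⟪(u : EuclideanSpace ℝ (Fin n)), x⟫ * h (act U (step x u))) ∂(sphereUniform n) := by
    rw [← hxy, avg_act, integral_sub hi1 hi2]
    rfl
  rw [hdiff, abs_le]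
  constructor
  · rw [← hval, ← integral_neg]
    exact integral_mono hbd.neg (hi1.sub hi2) fun u => (hpt u).1
  · rw [← hval]
    exact integral_mono (hi1.sub hi2) hbd fun u => (hpt u).2

lemma integrable_prod_of_continuous {F : UnitSphere n × UnitSphere n → ℝ} (hF : Continuous F) :
    Integrable F ((sphereUniform n).prod (sphereUniform n)) := by
  have := hF.continuousOn.integrableOn_compact
    (μ := (sphereUniform n).prod (sphereUniform n)) isCompact_univ
  rwa [integrableOn_univ] at this

/-! ### Reversibility and the Dirichlet form -/

/-- Reversibility of the walk. -/
lemma integral_step_swap {w : ℝ → ℝ} (hw : Continuous w) (hws : ∀ t, w (-t) = w t)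
    {Φ : UnitSphere n → UnitSphere n → ℝ}
    (hΦ : Continuous fun p : UnitSphere n × UnitSphere n => Φ p.1 p.2) :
    ∫ p : UnitSphere n × UnitSphere n, w ⟪(p.2 : EuclideanSpace ℝ (Fin n)), p.1⟫ *
        Φ (step p.1 p.2) p.1 ∂((sphereUniform n).prod (sphereUniform n)) =
      ∫ p : UnitSphere n × UnitSphere n, w ⟪(p.2 : EuclideanSpace ℝ (Fin n)), p.1⟫ *
        Φ p.1 (step p.1 p.2) ∂((sphereUniform n).prod (sphereUniform n)) := by
  have hwc : Continuous fun p : UnitSphere n × UnitSphere n =>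
      w ⟪(p.2 : EuclideanSpace ℝ (Fin n)), p.1⟫ := hw.comp (by fun_prop)
  have h1 : Continuous fun p : UnitSphere n × UnitSphere n => Φ (step p.1 p.2) p.1 :=
    Continuous.comp (g := fun p : UnitSphere n × UnitSphere n => Φ p.1 p.2) hΦ
      (continuous_step.prodMk continuous_fst)
  have h2 : Continuous fun p : UnitSphere n × UnitSphere n => Φ p.1 (step p.1 p.2) :=
    Continuous.comp (g := fun p : UnitSphere n × UnitSphere n => Φ p.1 p.2) hΦ
      (continuous_fst.prodMk continuous_step)
  -- Integrate over x first: for fixed u, the substitution x ↦ `step x u` is a measure-preserving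
  -- involution that negates ⟨u, x⟩, and w is even.
  rw [integral_prod_symm _ (integrable_prod_of_continuous (by fun_prop)),
    integral_prod_symm _ (integrable_prod_of_continuous (by fun_prop))]
  congr 1
  ext u
  rw [← integral_act (refl (u : EuclideanSpace ℝ (Fin n)))]
  simp only [← step_eq_act, step_step, inner_step, hws]

/-- The Dirichlet form of the walk. -/
lemma mul_integral_sub_integral_avg {w : ℝ → ℝ} (hw : Continuous w) (hws : ∀ t, w (-t) = w t)
    {Z : ℝ} (hZ : ∀ x : UnitSphere n,
      ∫ u, w ⟪(u : EuclideanSpace ℝ (Fin n)), x⟫ ∂(sphereUniform n) = Z)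
    {h g : UnitSphere n → ℝ} (hh : Continuous h) (hg : Continuous g) :
    Z * ∫ x, h x * g x ∂(sphereUniform n) - ∫ x, avg w h x * g x ∂(sphereUniform n) =
      (1 / 2) * ∫ x, ∫ u, w ⟪(u : EuclideanSpace ℝ (Fin n)), x⟫ *
        ((h x - h (step x u)) * (g x - g (step x u))) ∂(sphereUniform n) ∂(sphereUniform n) := by
  have hwc : Continuous fun p : UnitSphere n × UnitSphere n =>
      w ⟪(p.2 : EuclideanSpace ℝ (Fin n)), p.1⟫ := hw.comp (by fun_prop)
  have hhs : Continuous fun p : UnitSphere n × UnitSphere n => h (step p.1 p.2) :=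
    hh.comp continuous_step
  have hgs : Continuous fun p : UnitSphere n × UnitSphere n => g (step p.1 p.2) :=
    hg.comp continuous_step
  have hh1 : Continuous fun p : UnitSphere n × UnitSphere n => h p.1 := hh.comp continuous_fst
  have hg1 : Continuous fun p : UnitSphere n × UnitSphere n => g p.1 := hg.comp continuous_fst
  -- Expanding the product of differences gives four terms; reversibility identifies the two
  -- diagonal ones (`e1`) and the two cross ones (`e2`).
  have e1 := integral_step_swap hw hws (Φ := fun x _ => h x * g x) (hh1.mul hg1)
  have e2 := integral_step_swap hw hws (Φ := fun x y => h x * g y)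
    (hh1.mul (hg.comp continuous_snd))
  have i1 := integrable_prod_of_continuous (F := fun p : UnitSphere n × UnitSphere n =>
    w ⟪(p.2 : EuclideanSpace ℝ (Fin n)), p.1⟫ * (h p.1 * g p.1)) (by fun_prop)
  have i2 := integrable_prod_of_continuous (F := fun p : UnitSphere n × UnitSphere n =>
    w ⟪(p.2 : EuclideanSpace ℝ (Fin n)), p.1⟫ * (h (step p.1 p.2) * g (step p.1 p.2))) (by fun_prop)
  have i3 := integrable_prod_of_continuous (F := fun p : UnitSphere n × UnitSphere n =>
    w ⟪(p.2 : EuclideanSpace ℝ (Fin n)), p.1⟫ * (h (step p.1 p.2) * g p.1)) (by fun_prop)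
  have i4 := integrable_prod_of_continuous (F := fun p : UnitSphere n × UnitSphere n =>
    w ⟪(p.2 : EuclideanSpace ℝ (Fin n)), p.1⟫ * (h p.1 * g (step p.1 p.2))) (by fun_prop)
  have hI1 : ∫ p : UnitSphere n × UnitSphere n, w ⟪(p.2 : EuclideanSpace ℝ (Fin n)), p.1⟫ *
      (h p.1 * g p.1) ∂((sphereUniform n).prod (sphereUniform n)) =
      Z * ∫ x, h x * g x ∂(sphereUniform n) := by
    rw [integral_prod _ i1, ← integral_const_mul]
    congr 1
    ext x
    dsimp only
    rw [integral_mul_const, hZ]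
  have hI3 : ∫ p : UnitSphere n × UnitSphere n, w ⟪(p.2 : EuclideanSpace ℝ (Fin n)), p.1⟫ *
      (h (step p.1 p.2) * g p.1) ∂((sphereUniform n).prod (sphereUniform n)) =
      ∫ x, avg w h x * g x ∂(sphereUniform n) := by
    rw [integral_prod _ i3]
    congr 1
    ext x
    simp only [← mul_assoc]
    rw [integral_mul_const, avg]
  have hwhole := integrable_prod_of_continuous (F := fun p : UnitSphere n × UnitSphere n =>
    w ⟪(p.2 : EuclideanSpace ℝ (Fin n)), p.1⟫ * ((h p.1 - h (step p.1 p.2)) * (g p.1 - g (step p.1 p.2)))) (by fun_prop)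
  have hex : ∫ p : UnitSphere n × UnitSphere n, w ⟪(p.2 : EuclideanSpace ℝ (Fin n)), p.1⟫ *
      ((h p.1 - h (step p.1 p.2)) * (g p.1 - g (step p.1 p.2)))
        ∂((sphereUniform n).prod (sphereUniform n)) =
      (∫ p : UnitSphere n × UnitSphere n, w ⟪(p.2 : EuclideanSpace ℝ (Fin n)), p.1⟫ *
      (h p.1 * g p.1) ∂((sphereUniform n).prod (sphereUniform n)) +
      ∫ p : UnitSphere n × UnitSphere n, w ⟪(p.2 : EuclideanSpace ℝ (Fin n)), p.1⟫ *
      (h (step p.1 p.2) * g (step p.1 p.2)) ∂((sphereUniform n).prod (sphereUniform n))) -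
      (∫ p : UnitSphere n × UnitSphere n, w ⟪(p.2 : EuclideanSpace ℝ (Fin n)), p.1⟫ *
      (h (step p.1 p.2) * g p.1) ∂((sphereUniform n).prod (sphereUniform n)) +
      ∫ p : UnitSphere n × UnitSphere n, w ⟪(p.2 : EuclideanSpace ℝ (Fin n)), p.1⟫ *
      (h p.1 * g (step p.1 p.2)) ∂((sphereUniform n).prod (sphereUniform n))) := by
    rw [← integral_add i1 i2, ← integral_add i3 i4, ← integral_sub (by exact i1.add i2) (by exact i3.add i4)]
    congr 1
    ext p
    ring
  rw [← integral_prod _ hwhole, hex, e1, ← e2, hI1, hI3]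
  ring

lemma inner_step_right (a : EuclideanSpace ℝ (Fin n)) {x : UnitSphere n} (hax : ⟪a, x⟫ = 0)
    (u : UnitSphere n) : ⟪a, step x u⟫ =
      -(2 * ⟪(u : EuclideanSpace ℝ (Fin n)), x⟫ * ⟪(u : EuclideanSpace ℝ (Fin n)), a⟫) := by
  rw [coe_step, inner_sub_right, inner_smul_right, hax, real_inner_comm a]
  ring

/-- A Lipschitz function correlates with a linear function no more than the linear function
itself does, up to the factor comparing arcs and chords. -/
lemma GeoLip.integral_mul_inner_le {w : ℝ → ℝ} (hw : Continuous w)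
    (hw0 : ∀ t, 0 ≤ w t) {ε : ℝ} (hε : ε ≤ 1 / 4) (hwε : ∀ t, w t ≠ 0 → |t| ≤ ε) {D : ℝ}
    (hD : ∀ x : UnitSphere n, ∫ u, w ⟪(u : EuclideanSpace ℝ (Fin n)), x⟫ *
      (4 * ⟪(u : EuclideanSpace ℝ (Fin n)), x⟫ ^ 2 *
        (1 - ⟪(u : EuclideanSpace ℝ (Fin n)), x⟫ ^ 2)) ∂(sphereUniform n) = D)
    {L : ℝ} (hL : 0 ≤ L) {h : UnitSphere n → ℝ} (hh : GeoLip L h) {x a : UnitSphere n}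
    (hax : ⟪(a : EuclideanSpace ℝ (Fin n)), x⟫ = 0) :
    ((n : ℝ) - 1) * (1 - ε) * ∫ u, w ⟪(u : EuclideanSpace ℝ (Fin n)), x⟫ * ((h (step x u) - h x) *
      ⟪(a : EuclideanSpace ℝ (Fin n)), step x u⟫) ∂(sphereUniform n) ≤ L * D := by
  have hn1 : (0 : ℝ) ≤ n - 1 := by
    have : (1 : ℝ) ≤ n := by
      have : n ≠ 0 := by
        rintro rfl
        have h1 := norm_coe x
        have h0 : (x : EuclideanSpace ℝ (Fin 0)) = 0 := Subsingleton.elim _ _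
        rw [h0, norm_zero] at h1
        exact zero_ne_one h1
      exact_mod_cast Nat.one_le_iff_ne_zero.2 this
    linarith
  have hc := hh.continuous
  have hwc : Continuous fun u : UnitSphere n => w ⟪(u : EuclideanSpace ℝ (Fin n)), x⟫ :=
    hw.comp (by fun_prop)
  have hs := continuous_step_right x
  have hJ := integral_inner_sq (φ := fun t => w t * (4 * t ^ 2)) (by fun_prop) x a hax
  simp only [mul_assoc] at hJ hD
  rw [hD] at hJ
  -- The mirror symmetry S in a^⊥ fixes x and negates the linear function. Averaging I with its
  -- mirror image replaces h(y) - h(x) by half of h(y) - h(S y).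
  set S := refl (a : EuclideanSpace ℝ (Fin n)) with hS
  have hSx : act S x = x := by
    ext1
    rw [coe_act, hS, refl_apply (norm_coe a), hax]
    simp
  have hSS : ∀ y, act S y = step y a := fun y => (step_eq_act y a).symm
  set I := ∫ u, w ⟪(u : EuclideanSpace ℝ (Fin n)), x⟫ * ((h (step x u) - h x) *
      ⟪(a : EuclideanSpace ℝ (Fin n)), step x u⟫) ∂(sphereUniform n) with hI
  have hI' : I = ∫ u, w ⟪(u : EuclideanSpace ℝ (Fin n)), x⟫ * ((h (step (step x u) a) - h x) *
      -⟪(a : EuclideanSpace ℝ (Fin n)), step x u⟫) ∂(sphereUniform n) := by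
    rw [hI, ← integral_act S]
    congr 1
    ext u
    have h1 : step x (act S u) = step (step x u) a := by
      rw [← hSS (step x u), act_step, hSx]
    have h2 : ⟪(act S u : EuclideanSpace ℝ (Fin n)), x⟫ = ⟪(u : EuclideanSpace ℝ (Fin n)), x⟫ := by
      conv_lhs => rw [← hSx]
      rw [coe_act, coe_act, S.inner_map_map]
    rw [h1, h2, inner_step]
  have hin : Continuous fun u : UnitSphere n => ⟪(a : EuclideanSpace ℝ (Fin n)), step x u⟫ := by
    fun_prop
  have hc1 : Continuous fun u : UnitSphere n => w ⟪(u : EuclideanSpace ℝ (Fin n)), x⟫ *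
      ((h (step x u) - h x) * ⟪(a : EuclideanSpace ℝ (Fin n)), step x u⟫) :=
    hwc.mul (((hc.comp hs).sub continuous_const).mul hin)
  have hc2 : Continuous fun u : UnitSphere n => w ⟪(u : EuclideanSpace ℝ (Fin n)), x⟫ *
      ((h (step (step x u) a) - h x) * -⟪(a : EuclideanSpace ℝ (Fin n)), step x u⟫) :=
    hwc.mul (((hc.comp ((continuous_step_left a).comp hs)).sub continuous_const).mul hin.neg)
  have key : (1 - ε) * (I + I) ≤ 2 * L * ∫ u, w ⟪(u : EuclideanSpace ℝ (Fin n)), x⟫ *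
      (4 * (⟪(u : EuclideanSpace ℝ (Fin n)), x⟫ ^ 2 * ⟪(u : EuclideanSpace ℝ (Fin n)), a⟫ ^ 2))
        ∂(sphereUniform n) := by
    nth_rw 2 [hI']
    rw [hI, ← integral_add (integrable_of_continuous hc1) (integrable_of_continuous hc2),
      ← integral_const_mul, ← integral_const_mul]
    refine integral_mono (integrable_of_continuous (by fun_prop))
      (integrable_of_continuous (by fun_prop)) fun u => ?_
    simp only
    set t := ⟪(u : EuclideanSpace ℝ (Fin n)), x⟫ with ht
    set b := ⟪(u : EuclideanSpace ℝ (Fin n)), a⟫ with hb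
    set y := step x u with hy
    rcases eq_or_ne (w t) 0 with h0 | h0
    · simp [h0]
    have htε := hwε t h0
    have hay : ⟪(a : EuclideanSpace ℝ (Fin n)), y⟫ = -(2 * t * b) := inner_step_right _ hax u
    have hb1 : |b| ≤ 1 := by
      have := abs_real_inner_le_norm (u : EuclideanSpace ℝ (Fin n)) a
      rwa [norm_coe, norm_coe, mul_one] at this
    -- The chord from y to its mirror image is 2|⟨a, y⟩|, so the Lipschitz bound again produces ⟨a,
    -- y⟩². Its mean is D/(n-1) by `hJ`, which gives the sharp constant.
    have hnorm : ‖(y : EuclideanSpace ℝ (Fin n)) - step y a‖ = 4 * (|t| * |b|) := by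
      rw [norm_sub_rev, norm_step_sub, hay, abs_neg, abs_mul, abs_mul, abs_two]
      ring
    have hdist := geodesicDist_mul_le_of_norm_le hε (x := y) (y := step y a) (by
      rw [hnorm]
      nlinarith [abs_nonneg t, abs_nonneg b])
    rw [hnorm] at hdist
    have h1 : (h y - h (step y a)) * -(2 * t * b) ≤ L * geodesicDist y (step y a) *
        (2 * (|t| * |b|)) := by
      calc (h y - h (step y a)) * -(2 * t * b) ≤ |(h y - h (step y a)) * -(2 * t * b)| :=
            le_abs_self _
        _ = |h y - h (step y a)| * (2 * (|t| * |b|)) := by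
            rw [abs_mul, abs_neg, abs_mul, abs_mul, abs_two]
            ring
        _ ≤ _ := by gcongr; exact hh _ _
    rw [hay]
    have hε1 : 0 ≤ 1 - ε := by linarith
    calc (1 - ε) * (w t * ((h y - h x) * -(2 * t * b)) +
          w t * ((h (step y a) - h x) * - -(2 * t * b)))
        = w t * ((1 - ε) * ((h y - h (step y a)) * -(2 * t * b))) := by ring
      _ ≤ w t * ((1 - ε) * (L * geodesicDist y (step y a) * (2 * (|t| * |b|)))) := by
          gcongr
          exact hw0 t
      _ = w t * (L * ((1 - ε) * geodesicDist y (step y a)) * (2 * (|t| * |b|))) := by ring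
      _ ≤ w t * (L * (4 * (|t| * |b|)) * (2 * (|t| * |b|))) := by
          gcongr
          exact hw0 t
      _ = 2 * L * (w t * (4 * (|t| ^ 2 * |b| ^ 2))) := by ring
      _ = _ := by rw [sq_abs, sq_abs]
  have := mul_le_mul_of_nonneg_left key hn1
  rw [mul_left_comm _ (2 * L), hJ] at this
  linarith

/-- Bound on the Dirichlet form at a point in terms of the gradient there. -/
lemma GeoLip.local_dirichlet_le (hn : 2 ≤ n) {w : ℝ → ℝ} (hw : Continuous w)
    (hw0 : ∀ t, 0 ≤ w t) {ε : ℝ} (hε : ε ≤ 1 / 4) (hwε : ∀ t, w t ≠ 0 → |t| ≤ ε) {D : ℝ}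
    (hD : ∀ x : UnitSphere n, ∫ u, w ⟪(u : EuclideanSpace ℝ (Fin n)), x⟫ *
      (4 * ⟪(u : EuclideanSpace ℝ (Fin n)), x⟫ ^ 2 *
        (1 - ⟪(u : EuclideanSpace ℝ (Fin n)), x⟫ ^ 2)) ∂(sphereUniform n) = D)
    {L : ℝ} (hL : 0 ≤ L) {h : UnitSphere n → ℝ} (hh : GeoLip L h) {g : UnitSphere n → ℝ}
    (hg : Continuous g) {x : UnitSphere n} {a : EuclideanSpace ℝ (Fin n)} (hax : ⟪a, x⟫ = 0) :
    ∫ u, w ⟪(u : EuclideanSpace ℝ (Fin n)), x⟫ *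
        ((h x - h (step x u)) * (g x - g (step x u))) ∂(sphereUniform n) ≤
      L * (D / ((n - 1) * (1 - ε)) * ‖a‖ +
        ∫ u, w ⟪(u : EuclideanSpace ℝ (Fin n)), x⟫ * (‖(step x u : EuclideanSpace ℝ (Fin n)) - x‖ *
          (Real.pi / 2) * |g (step x u) - g x - ⟪a, step x u - x⟫|) ∂(sphereUniform n)) := by
  have hn1 : (0 : ℝ) < n - 1 := by
    have : (2 : ℝ) ≤ n := by exact_mod_cast hn
    linarith
  have hε1 : 0 < 1 - ε := by linarith
  have hc := hh.continuous
  have hwc : Continuous fun u : UnitSphere n => w ⟪(u : EuclideanSpace ℝ (Fin n)), x⟫ :=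
    hw.comp (by fun_prop)
  have hs := continuous_step_right x
  -- Split g(y) - g(x) into ⟨a, y - x⟩ = ⟨a, y⟩ and a Taylor error. Only the linear part needs the
  -- sharp constant; on the error a crude π/2 comparison of arc and chord is enough.
  have hlin : ∫ u, w ⟪(u : EuclideanSpace ℝ (Fin n)), x⟫ * ((h (step x u) - h x) *
      ⟪a, step x u⟫) ∂(sphereUniform n) ≤ L * (D / ((n - 1) * (1 - ε)) * ‖a‖) := by
    rcases eq_or_ne a 0 with rfl | ha
    · simp
    have ha' : 0 < ‖a‖ := norm_pos_iff.2 ha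
    have hb := hh.integral_mul_inner_le hw hw0 hε hwε hD hL (x := x)
      (a := ⟨‖a‖⁻¹ • a, by simp [norm_smul, ha]⟩) (by simp [inner_smul_left, hax])
    have h1 : ∫ u, w ⟪(u : EuclideanSpace ℝ (Fin n)), x⟫ * ((h (step x u) - h x) *
      ⟪a, step x u⟫) ∂(sphereUniform n) = ‖a‖ * ∫ u, w ⟪(u : EuclideanSpace ℝ (Fin n)), x⟫ *
        ((h (step x u) - h x) * ⟪‖a‖⁻¹ • a, step x u⟫) ∂(sphereUniform n) := by
      rw [← integral_const_mul]
      congr 1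
      ext u
      rw [inner_smul_left]
      simp only [conj_trivial]
      field_simp
    rw [h1]
    rw [← le_div_iff₀' (by positivity)] at hb
    calc _ ≤ ‖a‖ * (L * D / ((n - 1) * (1 - ε))) := by gcongr
      _ = _ := by ring
  refine le_trans ?_ ((add_le_add_left hlin _).trans_eq (mul_add _ _ _).symm)
  rw [← integral_const_mul, ← integral_add (integrable_of_continuous (by fun_prop))
    (integrable_of_continuous (by fun_prop))]
  refine integral_mono (integrable_of_continuous (by fun_prop))
    (integrable_of_continuous (by fun_prop)) fun u => ?_
  simp only
  set y := step x u with hy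
  have hsub : ⟪a, (y : EuclideanSpace ℝ (Fin n)) - x⟫ = ⟪a, y⟫ := by
    rw [inner_sub_right, hax, sub_zero]
  rw [hsub]
  have h1 : (h y - h x) * (g y - g x - ⟪a, y⟫) ≤
      L * (‖(y : EuclideanSpace ℝ (Fin n)) - x‖ * (Real.pi / 2) * |g y - g x - ⟪a, y⟫|) := by
    calc (h y - h x) * (g y - g x - ⟪a, y⟫) ≤ |(h y - h x) * (g y - g x - ⟪a, y⟫)| := le_abs_self _
      _ = |h y - h x| * |g y - g x - ⟪a, y⟫| := abs_mul _ _
      _ ≤ (L * (Real.pi / 2 * ‖(y : EuclideanSpace ℝ (Fin n)) - x‖)) * |g y - g x - ⟪a, y⟫| := by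
        gcongr
        refine (hh y x).trans ?_
        gcongr
        exact geodesicDist_le_pi_half_mul y x
      _ = _ := by ring
  have h2 := mul_le_mul_of_nonneg_left h1 (hw0 ⟪(u : EuclideanSpace ℝ (Fin n)), x⟫)
  linarith

/-! ### Covariance at a fixed step size -/

/-- The error of the first order expansion of `g` at `x`, averaged over one step of the walk. -/
noncomputable def remainder (w : ℝ → ℝ) (g : UnitSphere n → ℝ)
    (a : UnitSphere n → EuclideanSpace ℝ (Fin n)) (x : UnitSphere n) : ℝ :=
  ∫ u, w ⟪(u : EuclideanSpace ℝ (Fin n)), x⟫ * (‖(step x u : EuclideanSpace ℝ (Fin n)) - x‖ *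
    (Real.pi / 2) * |g (step x u) - g x - ⟪a x, step x u - x⟫|) ∂(sphereUniform n)

lemma remainder_nonneg {w : ℝ → ℝ} (hw0 : ∀ t, 0 ≤ w t) (g : UnitSphere n → ℝ)
    (a : UnitSphere n → EuclideanSpace ℝ (Fin n)) (x : UnitSphere n) :
    0 ≤ remainder w g a x :=
  integral_nonneg fun u => mul_nonneg (hw0 _) (by positivity)

/-- The field `a` is only measurable, so the integrand is dominated by a continuous one on the
product and Fubini applies. -/
lemma integrable_remainder {w : ℝ → ℝ} (hw : Continuous w) (hw0 : ∀ t, 0 ≤ w t)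
    {g : UnitSphere n → ℝ} (hg : Continuous g) {a : UnitSphere n → EuclideanSpace ℝ (Fin n)}
    (ha : Measurable a) {B : ℝ} (hB : ∀ x, ‖a x‖ ≤ B) :
    Integrable (remainder w g a) (sphereUniform n) := by
  have hwc : Continuous fun p : UnitSphere n × UnitSphere n =>
      w ⟪(p.2 : EuclideanSpace ℝ (Fin n)), p.1⟫ := hw.comp (by fun_prop)
  have hdom := integrable_prod_of_continuous
    (F := fun p : UnitSphere n × UnitSphere n => w ⟪(p.2 : EuclideanSpace ℝ (Fin n)), p.1⟫ *
      (‖(step p.1 p.2 : EuclideanSpace ℝ (Fin n)) - p.1‖ * (Real.pi / 2) *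
        (|g (step p.1 p.2) - g p.1| +
          B * ‖(step p.1 p.2 : EuclideanSpace ℝ (Fin n)) - p.1‖))) (by fun_prop)
  have hint : Integrable
      (fun p : UnitSphere n × UnitSphere n => w ⟪(p.2 : EuclideanSpace ℝ (Fin n)), p.1⟫ *
      (‖(step p.1 p.2 : EuclideanSpace ℝ (Fin n)) - p.1‖ * (Real.pi / 2) *
        |g (step p.1 p.2) - g p.1 - ⟪a p.1, step p.1 p.2 - p.1⟫|))
        ((sphereUniform n).prod (sphereUniform n)) := by
    refine hdom.mono' ?_ (ae_of_all _ fun p => ?_)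
    · have h1 : Measurable fun p : UnitSphere n × UnitSphere n =>
          ⟪a p.1, (step p.1 p.2 : EuclideanSpace ℝ (Fin n)) - p.1⟫ :=
        (ha.comp measurable_fst).inner
          (by fun_prop : Continuous fun p : UnitSphere n × UnitSphere n =>
            (step p.1 p.2 : EuclideanSpace ℝ (Fin n)) - p.1).measurable
      have h2 : Measurable fun p : UnitSphere n × UnitSphere n =>
          g (step p.1 p.2) - g p.1 - ⟪a p.1, (step p.1 p.2 : EuclideanSpace ℝ (Fin n)) - p.1⟫ :=
        (by fun_prop : Continuous fun p : UnitSphere n × UnitSphere n =>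
          g (step p.1 p.2) - g p.1).measurable.sub h1
      have h3 : Measurable fun p : UnitSphere n × UnitSphere n =>
          |g (step p.1 p.2) - g p.1 - ⟪a p.1, (step p.1 p.2 : EuclideanSpace ℝ (Fin n)) - p.1⟫| :=
        continuous_abs.measurable.comp h2
      exact (hwc.measurable.mul ((by fun_prop : Continuous fun p : UnitSphere n × UnitSphere n =>
        ‖(step p.1 p.2 : EuclideanSpace ℝ (Fin n)) - p.1‖ *
          (Real.pi / 2)).measurable.mul h3)).aestronglyMeasurable
    · rw [Real.norm_eq_abs, abs_of_nonneg (mul_nonneg (hw0 _) (by positivity))]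
      refine mul_le_mul_of_nonneg_left ?_ (hw0 _)
      refine mul_le_mul_of_nonneg_left ?_ (by positivity)
      refine (abs_sub _ _).trans ?_
      gcongr
      refine (abs_real_inner_le_norm _ _).trans ?_
      gcongr
      exact hB _
  exact hint.integral_prod_left

lemma GeoLip.abs_sub_integral_le [NeZero n] {L : ℝ} (hL : 0 ≤ L) {h : UnitSphere n → ℝ}
    (hh : GeoLip L h) (x : UnitSphere n) :
    |h x - ∫ y, h y ∂(sphereUniform n)| ≤ L * Real.pi := by
  have h1 : h x - ∫ y, h y ∂(sphereUniform n) = ∫ y, (h x - h y) ∂(sphereUniform n) := by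
    rw [integral_sub (integrable_const _) (integrable_of_continuous hh.continuous)]
    simp
  rw [h1, ← Real.norm_eq_abs]
  refine (norm_integral_le_of_norm_le_const (C := L * Real.pi) (ae_of_all _ fun y => ?_)).trans ?_
  · exact (hh x y).trans (mul_le_mul_of_nonneg_left (geodesicDist_le_pi x y) hL)
  · simp

/-- The covariance inequality at a positive step size. -/
lemma GeoLip.covariance_le_add_remainder (hn : 3 ≤ n) {w : ℝ → ℝ} (hw : Continuous w)
    (hw0 : ∀ t, 0 ≤ w t) (hws : ∀ t, w (-t) = w t) {ε : ℝ} (hε : ε ≤ 1 / 4)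
    (hwε : ∀ t, w t ≠ 0 → |t| ≤ ε) {Z D : ℝ} (hD0 : 0 < D) (hDZ : D ≤ Z)
    (hZ : ∀ x : UnitSphere n,
      ∫ u, w ⟪(u : EuclideanSpace ℝ (Fin n)), x⟫ ∂(sphereUniform n) = Z)
    (hD : ∀ x : UnitSphere n, ∫ u, w ⟪(u : EuclideanSpace ℝ (Fin n)), x⟫ *
      (4 * ⟪(u : EuclideanSpace ℝ (Fin n)), x⟫ ^ 2 *
        (1 - ⟪(u : EuclideanSpace ℝ (Fin n)), x⟫ ^ 2)) ∂(sphereUniform n) = D)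
    {f : UnitSphere n → ℝ} (hf : GeoLip 1 f) {g : UnitSphere n → ℝ} (hg : Continuous g)
    {a : UnitSphere n → EuclideanSpace ℝ (Fin n)} (ha : Measurable a) {B : ℝ}
    (hB : ∀ x, ‖a x‖ ≤ B) (hax : ∀ x : UnitSphere n, ⟪a x, x⟫ = 0) :
    ∫ x, f x * g x ∂(sphereUniform n) -
        (∫ x, f x ∂(sphereUniform n)) * ∫ x, g x ∂(sphereUniform n) ≤
      1 / (n - 2) * (1 / (1 - ε) * ∫ x, ‖a x‖ ∂(sphereUniform n) +
        (n - 1) * ∫ x, (1 / D) * remainder w g a x ∂(sphereUniform n)) := by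
  have hn3 : (3 : ℝ) ≤ n := by exact_mod_cast hn
  have : NeZero n := ⟨by omega⟩
  have hn1 : (0 : ℝ) < n - 1 := by linarith
  have hn2 : (0 : ℝ) < n - 2 := by linarith
  have hε1 : 0 < 1 - ε := by linarith
  have hZ0 : 0 < Z := hD0.trans_le hDZ
  -- The contraction rate of the normalized operator `K`.
  set κ := (n - 2) / (2 * (n - 1)) * D / Z with hκ
  have hκ0 : 0 < κ := by positivity
  have hκ1 : κ ≤ 1 := by
    rw [hκ, div_le_one hZ0]
    have : ((n : ℝ) - 2) / (2 * (n - 1)) ≤ 1 := by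
      rw [div_le_one (by positivity)]
      linarith
    nlinarith
  set q := 1 - κ with hq
  have hq0 : 0 ≤ q := by linarith
  have hq1 : q < 1 := by linarith
  set A := ∫ x, ‖a x‖ ∂(sphereUniform n) with hA
  have hA0 : 0 ≤ A := integral_nonneg fun x => norm_nonneg _
  set R := ∫ x, remainder w g a x ∂(sphereUniform n) with hR
  have hR0 : 0 ≤ R := integral_nonneg fun x => remainder_nonneg hw0 g a x
  -- Bounds the loss ⟨h, g⟩ - ⟨K h, g⟩ in one step for a 1-Lipschitz h.
  set b := 1 / (2 * Z) * (D / ((n - 1) * (1 - ε)) * A + R) with hb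
  have hb0 : 0 ≤ b := by positivity
  have hia : Integrable (fun x => ‖a x‖) (sphereUniform n) :=
    Integrable.of_bound ha.norm.aestronglyMeasurable B
      (ae_of_all _ fun x => by rw [norm_norm]; exact hB x)
  have hiR := integrable_remainder hw hw0 hg ha hB
  set K : (UnitSphere n → ℝ) → UnitSphere n → ℝ := fun h x => (1 / Z) * avg w h x with hK
  have hKlip : ∀ {L : ℝ} {h : UnitSphere n → ℝ}, 0 ≤ L → GeoLip L h → GeoLip (q * L) (K h) := by
    intro L h hL hh x y
    have h1 := hh.avg_contraction (by omega) hw hw0 hZ hD hL x y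
    rw [hK]
    simp only
    rw [← mul_sub, abs_mul, abs_of_nonneg (by positivity)]
    calc 1 / Z * |avg w h x - avg w h y| ≤ 1 / Z *
          (L * (Z - (n - 2) / (2 * (n - 1)) * D) * geodesicDist x y) := by gcongr
      _ = _ := by
        rw [hq, hκ]
        field_simp
  have hKdir : ∀ {h g' : UnitSphere n → ℝ}, Continuous h → Continuous g' →
      ∫ x, h x * g' x ∂(sphereUniform n) - ∫ x, K h x * g' x ∂(sphereUniform n) =
      (1 / (2 * Z)) * ∫ x, ∫ u, w ⟪(u : EuclideanSpace ℝ (Fin n)), x⟫ *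
        ((h x - h (step x u)) * (g' x - g' (step x u))) ∂(sphereUniform n)
          ∂(sphereUniform n) := by
    intro h g' hh hg'
    have h1 := mul_integral_sub_integral_avg hw hws hZ hh hg'
    have h2 : ∫ x, K h x * g' x ∂(sphereUniform n) =
        (1 / Z) * ∫ x, avg w h x * g' x ∂(sphereUniform n) := by
      rw [← integral_const_mul]
      simp only [hK, mul_assoc]
    rw [h2]
    calc _ = (1 / Z) * (Z * ∫ x, h x * g' x ∂(sphereUniform n) -
          ∫ x, avg w h x * g' x ∂(sphereUniform n)) := by field_simp
      _ = _ := by rw [h1]; ring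
  have hKb : ∀ {L : ℝ} {h : UnitSphere n → ℝ}, 0 ≤ L → GeoLip L h →
      ∫ x, h x * g x ∂(sphereUniform n) - ∫ x, K h x * g x ∂(sphereUniform n) ≤ L * b := by
    intro L h hL hh
    have hhc := hh.continuous
    have hwc : Continuous fun p : UnitSphere n × UnitSphere n =>
      w ⟪(p.2 : EuclideanSpace ℝ (Fin n)), p.1⟫ := hw.comp (by fun_prop)
    rw [hKdir hhc hg]
    have hi : Integrable (fun x : UnitSphere n => ∫ u, w ⟪(u : EuclideanSpace ℝ (Fin n)), x⟫ *
        ((h x - h (step x u)) * (g x - g (step x u))) ∂(sphereUniform n)) (sphereUniform n) :=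
      (integrable_prod_of_continuous (F := fun p : UnitSphere n × UnitSphere n =>
        w ⟪(p.2 : EuclideanSpace ℝ (Fin n)), p.1⟫ *
        ((h p.1 - h (step p.1 p.2)) * (g p.1 - g (step p.1 p.2))))
        (by fun_prop)).integral_prod_left
    calc _ ≤ 1 / (2 * Z) * ∫ x, L * (D / ((n - 1) * (1 - ε)) * ‖a x‖ + remainder w g a x)
          ∂(sphereUniform n) := by
          refine mul_le_mul_of_nonneg_left ?_ (by positivity)
          refine integral_mono hi (((hia.const_mul _).add hiR).const_mul _) fun x => ?_
          exact hh.local_dirichlet_le (by omega) hw hw0 hε hwε hD hL hg (hax x)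
      _ = _ := by
          rw [integral_const_mul, integral_add (hia.const_mul _) hiR, integral_const_mul]
          ring
  have hKmean : ∀ {h : UnitSphere n → ℝ}, Continuous h →
      ∫ x, K h x ∂(sphereUniform n) = ∫ x, h x ∂(sphereUniform n) := by
    intro h hh
    -- The Dirichlet form against a constant vanishes.
    have := hKdir (g' := fun _ => 1) hh continuous_const
    simp at this
    linarith
  set F : ℕ → UnitSphere n → ℝ := fun k => K^[k] f with hF
  have hFs : ∀ k, F (k + 1) = K (F k) := fun k => Function.iterate_succ_apply' K k f
  have hFlip : ∀ k, GeoLip (q ^ k) (F k) := by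
    intro k
    induction k with
    | zero => simpa [hF] using hf
    | succ k ih => rw [hFs, pow_succ']; exact hKlip (by positivity) ih
  have hFmean : ∀ k, ∫ x, F k x ∂(sphereUniform n) = ∫ x, f x ∂(sphereUniform n) := by
    intro k
    induction k with
    | zero => simp [hF]
    | succ k ih => rw [hFs, hKmean (hFlip k).continuous, ih]
  -- Telescoping: the i-th iterate is q^i-Lipschitz, so its step loses at most q^i b.
  have hsum : ∀ k, ∫ x, f x * g x ∂(sphereUniform n) - ∫ x, F k x * g x ∂(sphereUniform n) ≤
      (∑ i ∈ Finset.range k, q ^ i) * b := by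
    intro k
    induction k with
    | zero => simp [hF]
    | succ k ih =>
      have h1 := hKb (by positivity) (hFlip k)
      rw [← hFs] at h1
      rw [Finset.sum_range_succ, add_mul]
      linarith
  have hgeo : ∀ k, (∑ i ∈ Finset.range k, q ^ i) ≤ 1 / κ := by
    intro k
    have h1 := mul_neg_geom_sum q k
    rw [show 1 - q = κ by rw [hq]; ring] at h1
    rw [le_div_iff₀ hκ0, mul_comm, h1]
    linarith [pow_nonneg hq0 k]
  have hlim : ∀ k, ∫ x, f x * g x ∂(sphereUniform n) -
        (∫ x, f x ∂(sphereUniform n)) * ∫ x, g x ∂(sphereUniform n) ≤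
      1 / κ * b + q ^ k * (Real.pi * ∫ x, |g x| ∂(sphereUniform n)) := by
    intro k
    -- The k-th iterate keeps the mean of f and is within q^k π of it, π being the diameter of the
    -- sphere.
    have h1 : ∫ x, F k x * g x ∂(sphereUniform n) -
        (∫ x, f x ∂(sphereUniform n)) * ∫ x, g x ∂(sphereUniform n) ≤
        q ^ k * (Real.pi * ∫ x, |g x| ∂(sphereUniform n)) := by
      have hFc := (hFlip k).continuous
      rw [← hFmean k, ← integral_const_mul, ← integral_sub (integrable_of_continuous (by fun_prop))
        (integrable_of_continuous (by fun_prop)), ← integral_const_mul, ← integral_const_mul]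
      refine integral_mono (integrable_of_continuous (by fun_prop))
        (integrable_of_continuous (by fun_prop)) fun x => ?_
      simp only
      rw [← sub_mul, ← mul_assoc]
      refine (le_abs_self _).trans ?_
      rw [abs_mul]
      gcongr
      exact (hFlip k).abs_sub_integral_le (by positivity) x
    have h2 := mul_le_mul_of_nonneg_right (hgeo k) hb0
    linarith [hsum k]
  have hfinal : ∫ x, f x * g x ∂(sphereUniform n) -
        (∫ x, f x ∂(sphereUniform n)) * ∫ x, g x ∂(sphereUniform n) ≤ 1 / κ * b := by
    have ht : Tendsto (fun k : ℕ => 1 / κ * b +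
        q ^ k * (Real.pi * ∫ x, |g x| ∂(sphereUniform n))) atTop (𝓝 (1 / κ * b + 0 *
          (Real.pi * ∫ x, |g x| ∂(sphereUniform n)))) :=
      tendsto_const_nhds.add ((tendsto_pow_atTop_nhds_zero_of_lt_one hq0 hq1).mul_const _)
    rw [zero_mul, add_zero] at ht
    exact ge_of_tendsto' ht hlim
  refine hfinal.trans_eq ?_
  rw [integral_const_mul, ← hR, hκ, hb]
  field_simp

/-! ### The weights -/

/-- The tent function of half-width `ε`. -/
noncomputable def weight (ε t : ℝ) : ℝ := max (ε - |t|) 0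

lemma continuous_weight (ε : ℝ) : Continuous (weight ε) := by
  unfold weight
  fun_prop

lemma weight_nonneg (ε t : ℝ) : 0 ≤ weight ε t := le_max_right _ _

lemma weight_neg (ε t : ℝ) : weight ε (-t) = weight ε t := by simp [weight]

lemma abs_le_of_weight_ne_zero {ε t : ℝ} (h : weight ε t ≠ 0) : |t| ≤ ε := by
  by_contra! h1
  exact h (max_eq_right (by linarith))

/-- The mean square sine of the length of a step of the walk, unnormalized. -/
noncomputable def weightVariance (ε : ℝ) (x : UnitSphere n) : ℝ :=
  ∫ u, weight ε ⟪(u : EuclideanSpace ℝ (Fin n)), x⟫ *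
      (4 * ⟪(u : EuclideanSpace ℝ (Fin n)), x⟫ ^ 2 *
        (1 - ⟪(u : EuclideanSpace ℝ (Fin n)), x⟫ ^ 2)) ∂(sphereUniform n)

lemma inner_sq_le_one (u x : UnitSphere n) : ⟪(u : EuclideanSpace ℝ (Fin n)), x⟫ ^ 2 ≤ 1 := by
  rw [sq_le_one_iff_abs_le_one]
  have := abs_real_inner_le_norm (u : EuclideanSpace ℝ (Fin n)) x
  rwa [norm_coe, norm_coe, mul_one] at this

/-- The integrand is continuous and nonnegative, and it is positive at the unit vector with
x-component ε/2. -/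
lemma weightVariance_pos (hn : 2 ≤ n) {ε : ℝ} (hε0 : 0 < ε) (hε : ε ≤ 1 / 4) (x : UnitSphere n) :
    0 < weightVariance ε x := by
  have : NeZero n := ⟨by omega⟩
  have hwc := continuous_weight ε
  have hc : Continuous fun u : UnitSphere n => weight ε ⟪(u : EuclideanSpace ℝ (Fin n)), x⟫ *
      (4 * ⟪(u : EuclideanSpace ℝ (Fin n)), x⟫ ^ 2 *
        (1 - ⟪(u : EuclideanSpace ℝ (Fin n)), x⟫ ^ 2)) := by fun_prop
  obtain ⟨e, he⟩ := exists_unit_orthogonal hn x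
  have hxe : ⟪(x : EuclideanSpace ℝ (Fin n)), e⟫ = 0 := by rw [real_inner_comm, he]
  set s := √(1 - (ε / 2) ^ 2) with hs
  have hs2 : s ^ 2 = 1 - (ε / 2) ^ 2 := Real.sq_sqrt (by nlinarith)
  have hnorm : ‖(ε / 2) • (x : EuclideanSpace ℝ (Fin n)) + s • (e : EuclideanSpace ℝ (Fin n))‖
      = 1 := by
    rw [← sq_eq_sq₀ (norm_nonneg _) one_pos.le, norm_add_sq_real, norm_smul, norm_smul,
      norm_coe, norm_coe, inner_smul_left, inner_smul_right, hxe]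
    simp [hs2, div_pow]
  refine hc.integral_pos_of_hasCompactSupport_nonneg_nonzero (HasCompactSupport.of_compactSpace _)
    (fun u => ?_) (x := ⟨_, mem_sphere_zero_iff_norm.2 hnorm⟩) ?_
  · have := inner_sq_le_one u x
    have := weight_nonneg ε ⟪(u : EuclideanSpace ℝ (Fin n)), x⟫
    simp only [Pi.zero_apply]
    have : 0 ≤ 1 - ⟪(u : EuclideanSpace ℝ (Fin n)), x⟫ ^ 2 := by linarith
    positivity
  · have hin : ⟪(ε / 2) • (x : EuclideanSpace ℝ (Fin n)) + s • (e : EuclideanSpace ℝ (Fin n)), x⟫ =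
        ε / 2 := by
      rw [inner_add_left, inner_smul_left, inner_smul_left, inner_self, he]
      simp
    simp only [hin]
    have h1 : weight ε (ε / 2) = ε / 2 := by
      rw [weight, abs_of_pos (by positivity), max_eq_left (by linarith)]
      ring
    rw [h1]
    have : 0 < 1 - (ε / 2) ^ 2 := by nlinarith
    positivity

/-- A step has chord 2|t| ≤ 2ε, so both factors of the error are linear in |t|; 1/2 ≤ 1 - t² then
brings in the variance. Dividing by the variance leaves πη whatever the step size. -/
lemma remainder_weight_le {ε : ℝ} (hε : ε ≤ 1 / 4) {g : UnitSphere n → ℝ} (hg : Continuous g)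
    {a : UnitSphere n → EuclideanSpace ℝ (Fin n)} {x : UnitSphere n} {η : ℝ} (hη : 0 ≤ η)
    (h : ∀ y : UnitSphere n, ‖(y : EuclideanSpace ℝ (Fin n)) - x‖ ≤ 2 * ε →
      |g y - g x - ⟪a x, y - x⟫| ≤ η * ‖(y : EuclideanSpace ℝ (Fin n)) - x‖) :
    remainder (weight ε) g a x ≤ Real.pi * η * weightVariance ε x := by
  have hwc := continuous_weight ε
  have hs := continuous_step_right x
  rw [remainder, weightVariance, ← integral_const_mul]
  refine integral_mono (integrable_of_continuous (by fun_prop))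
    (integrable_of_continuous (by fun_prop)) fun u => ?_
  simp only
  set t := ⟪(u : EuclideanSpace ℝ (Fin n)), x⟫ with ht
  rcases eq_or_ne (weight ε t) 0 with h0 | h0
  · simp [h0]
  have htε := abs_le_of_weight_ne_zero h0
  have hn := norm_step_sub x u
  rw [← ht] at hn
  have h1 := h (step x u) (by rw [hn]; linarith)
  have hpi := Real.pi_pos
  have ht2 : t ^ 2 ≤ 1 / 2 := by
    rw [← sq_abs]
    nlinarith [abs_nonneg t]
  calc _ ≤ weight ε t * (‖(step x u : EuclideanSpace ℝ (Fin n)) - x‖ * (Real.pi / 2) *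
        (η * ‖(step x u : EuclideanSpace ℝ (Fin n)) - x‖)) := by
        gcongr
        exact weight_nonneg _ _
    _ = weight ε t * (Real.pi * η * (4 * |t| ^ 2 * (1 / 2))) := by rw [hn]; ring
    _ ≤ weight ε t * (Real.pi * η * (4 * |t| ^ 2 * (1 - t ^ 2))) := by
        gcongr
        · exact weight_nonneg _ _
        · linarith
    _ = _ := by rw [sq_abs]; ring

/-- Covariance inequality on the sphere: a Lipschitz function `f` and a function `g` with
gradient `a` satisfy `cov(f, g) ≤ (n - 2)⁻¹ ∫ |∇g|`. -/
theorem GeoLip.covariance_le (hn : 3 ≤ n) {f : UnitSphere n → ℝ} (hf : GeoLip 1 f)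
    {G : ℝ} {g : UnitSphere n → ℝ} (hg : GeoLip G g)
    {a : UnitSphere n → EuclideanSpace ℝ (Fin n)} (ha : Measurable a) {B : ℝ}
    (hB : ∀ x, ‖a x‖ ≤ B) (hax : ∀ x : UnitSphere n, ⟪a x, x⟫ = 0)
    (hdiff : ∀ᵐ x ∂(sphereUniform n),
      (fun y : UnitSphere n => g y - g x - ⟪a x, y - x⟫) =o[𝓝 x]
        fun y => (y : EuclideanSpace ℝ (Fin n)) - x) :
    ∫ x, f x * g x ∂(sphereUniform n) -
        (∫ x, f x ∂(sphereUniform n)) * ∫ x, g x ∂(sphereUniform n) ≤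
      1 / (n - 2) * ∫ x, ‖a x‖ ∂(sphereUniform n) := by
  have : NeZero n := ⟨by omega⟩
  have hgc := hg.continuous
  have : Nonempty (UnitSphere n) := (sphereUniform n).nonempty_of_neZero
  obtain ⟨p⟩ := this
  set ε : ℕ → ℝ := fun k => 1 / 4 / (k + 1) with hεdef
  have hε0 : ∀ k, 0 < ε k := fun k => by positivity
  have hε : ∀ k, ε k ≤ 1 / 4 := fun k => by
    rw [hεdef]
    exact div_le_self (by norm_num) (by simp)
  have hεlim : Tendsto ε atTop (𝓝 0) := by
    simpa [hεdef, div_eq_mul_inv] using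
      (tendsto_one_div_add_atTop_nhds_zero_nat (𝕜 := ℝ)).const_mul 4⁻¹
  set D : ℕ → ℝ := fun k => weightVariance (ε k) p with hDdef
  have hD0 : ∀ k, 0 < D k := fun k => weightVariance_pos (by omega) (hε0 k) (hε k) p
  have hD : ∀ k (x : UnitSphere n), weightVariance (ε k) x = D k := fun k x =>
    integral_inner_eq (fun t => weight (ε k) t * (4 * t ^ 2 * (1 - t ^ 2))) x p
  have hmain : ∀ k, ∫ x, f x * g x ∂(sphereUniform n) -
        (∫ x, f x ∂(sphereUniform n)) * ∫ x, g x ∂(sphereUniform n) ≤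
      1 / (n - 2) * (1 / (1 - ε k) * ∫ x, ‖a x‖ ∂(sphereUniform n) +
        (n - 1) * ∫ x, (1 / D k) * remainder (weight (ε k)) g a x ∂(sphereUniform n)) := by
    intro k
    have hwc := continuous_weight (ε k)
    refine hf.covariance_le_add_remainder hn hwc (weight_nonneg _)
      (weight_neg _) (hε k) (fun t => abs_le_of_weight_ne_zero) (hD0 k) ?_
      (fun x => integral_inner_eq (weight (ε k)) x p) (hD k) hgc ha hB hax
    refine integral_mono (integrable_of_continuous (by fun_prop))
      (integrable_of_continuous (by fun_prop)) fun u => ?_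
    refine mul_le_of_le_one_right (weight_nonneg _ _) ?_
    -- D ≤ Z because 4t²(1-t²) = 1 - (2t²-1)².
    nlinarith [sq_nonneg (2 * ⟪(u : EuclideanSpace ℝ (Fin n)), p⟫ ^ 2 - 1)]
  -- Crude Lipschitz constant of the Taylor error; πC dominates the normalized remainders uniformly
  -- in k.
  set C := |G| * (Real.pi / 2) + B with hC
  have hpi := Real.pi_pos
  have hB0 : 0 ≤ B := (norm_nonneg _).trans (hB p)
  have hC0 : 0 ≤ C := by positivity
  have hrem : Tendsto (fun k => ∫ x, (1 / D k) * remainder (weight (ε k)) g a x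
      ∂(sphereUniform n)) atTop (𝓝 (∫ _, (0 : ℝ) ∂(sphereUniform n))) := by
    refine tendsto_integral_of_dominated_convergence (fun _ => Real.pi * C)
      (fun k => ((integrable_remainder (continuous_weight _) (weight_nonneg _) hgc ha
        hB).const_mul _).aestronglyMeasurable) (integrable_const _) (fun k => ae_of_all _ fun x => ?_)
      ?_
    · rw [Real.norm_eq_abs, abs_of_nonneg (mul_nonneg (by have := hD0 k; positivity)
        (remainder_nonneg (weight_nonneg _) g a x)), one_div, inv_mul_le_iff₀ (hD0 k)]
      refine (remainder_weight_le (hε k) hgc hC0 fun y _ => ?_).trans_eq ?_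
      · calc |g y - g x - ⟪a x, y - x⟫| ≤ |g y - g x| + |⟪a x, (y : EuclideanSpace ℝ (Fin n)) - x⟫| :=
              abs_sub _ _
          _ ≤ |G| * (Real.pi / 2 * ‖(y : EuclideanSpace ℝ (Fin n)) - x‖) +
              B * ‖(y : EuclideanSpace ℝ (Fin n)) - x‖ := by
              gcongr
              · refine (hg y x).trans ?_
                gcongr
                · exact geodesicDist_nonneg _ _
                · exact le_abs_self G
                · exact geodesicDist_le_pi_half_mul y x
              · refine (abs_real_inner_le_norm _ _).trans ?_
                gcongr
                exact hB x
          _ = _ := by rw [hC]; ring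
      · rw [hD]; ring
    · filter_upwards [hdiff] with x hx
      rw [Metric.tendsto_atTop]
      intro δ hδ
      -- Chosen so that the factor π of `remainder_weight_le` yields δ/2.
      have hη : 0 < δ / 2 / Real.pi := by positivity
      have h1 := hx.def hη
      obtain ⟨ρ, hρ, hball⟩ := Metric.eventually_nhds_iff.1 h1
      have h2 : ∀ᶠ k in atTop, ε k < ρ / 2 := hεlim.eventually_lt_const (by positivity)
      obtain ⟨N, hN⟩ := eventually_atTop.1 h2
      refine ⟨N, fun k hk => ?_⟩
      rw [Real.dist_eq, sub_zero, abs_of_nonneg (mul_nonneg (by have := hD0 k; positivity)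
        (remainder_nonneg (weight_nonneg _) g a x))]
      refine lt_of_le_of_lt ?_ (half_lt_self hδ)
      rw [one_div, inv_mul_le_iff₀ (hD0 k)]
      refine (remainder_weight_le (hε k) hgc hη.le fun y hy => ?_).trans_eq ?_
      · refine hball ?_
        rw [Subtype.dist_eq, dist_eq_norm]
        linarith [hN k hk]
      · rw [hD]
        field_simp
  rw [integral_zero] at hrem
  have hlim : Tendsto (fun k => 1 / ((n : ℝ) - 2) * (1 / (1 - ε k) *
      ∫ x, ‖a x‖ ∂(sphereUniform n) +
        (n - 1) * ∫ x, (1 / D k) * remainder (weight (ε k)) g a x ∂(sphereUniform n))) atTop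
      (𝓝 (1 / ((n : ℝ) - 2) * (1 / (1 - 0) * ∫ x, ‖a x‖ ∂(sphereUniform n) + (n - 1) * 0))) := by
    refine Tendsto.const_mul _ (Tendsto.add (Tendsto.mul_const _ ?_) (hrem.const_mul _))
    exact tendsto_const_nhds.div (tendsto_const_nhds.sub hεlim) (by norm_num)
  simp only [sub_zero, div_one, one_mul, mul_zero, add_zero] at hlim
  exact ge_of_tendsto' hlim hmain

/-! ### Almost everywhere differentiability -/

/-- The extension of a function on the sphere that is constant along rays. -/
noncomputable def radialExt (f : UnitSphere n → ℝ) (z : EuclideanSpace ℝ (Fin n)) : ℝ :=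
  if h : z = 0 then 0 else f ⟨‖z‖⁻¹ • z, by simp [norm_smul, h]⟩

lemma radialExt_of_ne_zero (f : UnitSphere n → ℝ) {z : EuclideanSpace ℝ (Fin n)} (h : z ≠ 0) :
    radialExt f z = f ⟨‖z‖⁻¹ • z, by simp [norm_smul, h]⟩ := dif_neg h

lemma coe_ne_zero (x : UnitSphere n) : (x : EuclideanSpace ℝ (Fin n)) ≠ 0 := by
  rw [← norm_pos_iff, norm_coe]
  exact one_pos

lemma radialExt_coe (f : UnitSphere n → ℝ) (x : UnitSphere n) : radialExt f x = f x := by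
  rw [radialExt_of_ne_zero f (coe_ne_zero x)]
  congr 1
  ext1
  simp

lemma radialExt_smul (f : UnitSphere n → ℝ) {c : ℝ} (hc : 0 < c)
    (z : EuclideanSpace ℝ (Fin n)) : radialExt f (c • z) = radialExt f z := by
  rcases eq_or_ne z 0 with rfl | hz
  · simp
  rw [radialExt_of_ne_zero f hz, radialExt_of_ne_zero f (smul_ne_zero hc.ne' hz)]
  congr 2
  rw [norm_smul, Real.norm_eq_abs, abs_of_pos hc, smul_smul]
  congr 1
  field_simp

lemma GeoLip.abs_radialExt_sub_le {f : UnitSphere n → ℝ} (hf : GeoLip 1 f)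
    {z z' : EuclideanSpace ℝ (Fin n)} (hz : z ≠ 0) (hz' : z' ≠ 0) :
    |radialExt f z - radialExt f z'| ≤ InnerProductGeometry.angle z z' := by
  rw [radialExt_of_ne_zero f hz, radialExt_of_ne_zero f hz']
  refine (hf _ _).trans_eq ?_
  rw [one_mul, geodesicDist]
  simp only
  rw [InnerProductGeometry.angle_smul_left_of_pos _ _ (by positivity),
    InnerProductGeometry.angle_smul_right_of_pos _ _ (by positivity)]

lemma norm_normalize_sub_le {E : Type*} [NormedAddCommGroup E] [NormedSpace ℝ E] {z z' : E}
    (hz : z ≠ 0) (hz' : z' ≠ 0) : ‖‖z‖⁻¹ • z - ‖z'‖⁻¹ • z'‖ ≤ 2 / ‖z‖ * ‖z - z'‖ := by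
  have h1 : ‖z‖⁻¹ • z - ‖z'‖⁻¹ • z' = ‖z‖⁻¹ • (z - z') + (‖z‖⁻¹ - ‖z'‖⁻¹) • z' := by module
  have h0 : 0 < ‖z‖ := norm_pos_iff.2 hz
  have h0' : 0 < ‖z'‖ := norm_pos_iff.2 hz'
  have h2 : ‖(‖z‖⁻¹ - ‖z'‖⁻¹) • z'‖ ≤ ‖z‖⁻¹ * ‖z - z'‖ := by
    rw [norm_smul, Real.norm_eq_abs]
    have : ‖z‖⁻¹ - ‖z'‖⁻¹ = ‖z‖⁻¹ * (‖z'‖ - ‖z‖) * ‖z'‖⁻¹ := by field_simp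
    rw [this, abs_mul, abs_mul, abs_inv, abs_inv, abs_norm, abs_norm,
      inv_mul_cancel_right₀ h0'.ne']
    gcongr
    rw [norm_sub_rev]
    exact abs_norm_sub_norm_le _ _
  rw [h1]
  refine (norm_add_le _ _).trans ?_
  rw [norm_smul, norm_inv, norm_norm]
  calc _ ≤ ‖z‖⁻¹ * ‖z - z'‖ + ‖z‖⁻¹ * ‖z - z'‖ := by gcongr
    _ = _ := by ring

/-- Normalization is Lipschitz only away from the origin; these sets exhaust the punctured space, so
the Euclidean Rademacher theorem applies piecewise. -/
lemma GeoLip.lipschitzOnWith_radialExt {f : UnitSphere n → ℝ} (hf : GeoLip 1 f) {r : ℝ}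
    (hr : 0 < r) :
    LipschitzOnWith (Real.toNNReal (Real.pi / r)) (radialExt f) {z | r < ‖z‖} := by
  refine LipschitzOnWith.of_dist_le_mul fun z hz z' hz' => ?_
  simp only [mem_ofPred_eq] at hz hz'
  have h0 : z ≠ 0 := norm_pos_iff.1 (hr.trans hz)
  have h0' : z' ≠ 0 := norm_pos_iff.1 (hr.trans hz')
  have hpi := Real.pi_pos
  rw [Real.coe_toNNReal _ (by positivity), Real.dist_eq, dist_eq_norm,
    radialExt_of_ne_zero f h0, radialExt_of_ne_zero f h0']
  refine (hf _ _).trans ?_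
  rw [one_mul]
  refine (geodesicDist_le_pi_half_mul _ _).trans ?_
  calc _ ≤ Real.pi / 2 * (2 / ‖z‖ * ‖z - z'‖) := by
        gcongr
        exact norm_normalize_sub_le h0 h0'
    _ ≤ Real.pi / 2 * (2 / r * ‖z - z'‖) := by gcongr
    _ = _ := by ring

lemma GeoLip.ae_differentiableAt_radialExt_volume {f : UnitSphere n → ℝ} (hf : GeoLip 1 f) :
    ∀ᵐ z : EuclideanSpace ℝ (Fin n), z ≠ 0 → DifferentiableAt ℝ (radialExt f) z := by
  have h1 : ∀ k : ℕ, ∀ᵐ z : EuclideanSpace ℝ (Fin n),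
      z ∈ {z : EuclideanSpace ℝ (Fin n) | 1 / ((k : ℝ) + 1) < ‖z‖} →
        DifferentiableWithinAt ℝ (radialExt f) {z | 1 / ((k : ℝ) + 1) < ‖z‖} z :=
    fun k => (hf.lipschitzOnWith_radialExt (by positivity)).ae_differentiableWithinAt_of_mem
  filter_upwards [ae_all_iff.2 h1] with z hz hz0
  obtain ⟨k, hk⟩ := exists_nat_one_div_lt (norm_pos_iff.2 hz0)
  exact (hz k hk).differentiableAt ((isOpen_lt continuous_const continuous_norm).mem_nhds hk)

lemma differentiableAt_radialExt_of_smul {f : UnitSphere n → ℝ} {c : ℝ} (hc : 0 < c)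
    {z : EuclideanSpace ℝ (Fin n)} (h : DifferentiableAt ℝ (radialExt f) (c • z)) :
    DifferentiableAt ℝ (radialExt f) z := by
  have h1 : radialExt f = radialExt f ∘ fun z => c • z := by
    ext1 z
    exact (radialExt_smul f hc z).symm
  rw [h1]
  exact DifferentiableAt.comp z h (by fun_prop)

/-- Differentiability is invariant under positive scaling, so the cone over the bad set consists of
bad points. That cone is Lebesgue null, hence the bad set is null on the sphere. -/
lemma GeoLip.ae_differentiableAt_radialExt {f : UnitSphere n → ℝ} (hf : GeoLip 1 f) :
    ∀ᵐ x : UnitSphere n ∂(sphereUniform n), DifferentiableAt ℝ (radialExt f) x := by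
  have hmeas : MeasurableSet {x : UnitSphere n | ¬ DifferentiableAt ℝ (radialExt f) x} :=
    measurable_subtype_coe (measurableSet_of_differentiableAt ℝ (radialExt f)).compl
  refine Measure.ae_smul_measure ?_ _
  rw [ae_iff, Measure.toSphere_apply' _ hmeas]
  refine mul_eq_zero_of_right _ (measure_mono_null ?_ (ae_iff.1
    hf.ae_differentiableAt_radialExt_volume))
  rintro _ ⟨t, ht, _, ⟨x, hx, rfl⟩, rfl⟩
  simp only [mem_ofPred_eq] at hx ⊢
  exact fun h => hx (differentiableAt_radialExt_of_smul ht.1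
    (h (smul_ne_zero ht.1.ne' (coe_ne_zero x))))

lemma fderiv_radialExt_self (f : UnitSphere n → ℝ) (x : UnitSphere n) :
    fderiv ℝ (radialExt f) x (x : EuclideanSpace ℝ (Fin n)) = 0 := by
  by_cases h : DifferentiableAt ℝ (radialExt f) x
  swap
  · simp [fderiv_zero_of_not_differentiableAt h]
  have h1 : HasDerivAt (fun s : ℝ => radialExt f ((x : EuclideanSpace ℝ (Fin n)) + s • x))
      (fderiv ℝ (radialExt f) x (x : EuclideanSpace ℝ (Fin n))) 0 :=
    h.hasFDerivAt.hasLineDerivAt _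
  have h2 : (fun s : ℝ => radialExt f ((x : EuclideanSpace ℝ (Fin n)) + s • x)) =ᶠ[𝓝 0]
      fun _ => radialExt f x := by
    filter_upwards [lt_mem_nhds (show (-1 : ℝ) < 0 by norm_num)] with s hs
    have : (x : EuclideanSpace ℝ (Fin n)) + s • (x : EuclideanSpace ℝ (Fin n)) =
        (1 + s) • (x : EuclideanSpace ℝ (Fin n)) := by module
    rw [this, radialExt_smul f (by linarith)]
  exact (h1.congr_of_eventuallyEq h2.symm).unique (hasDerivAt_const _ _)

/-- The angle between x and x + s v is arctan(|s|‖v‖) ≤ |s|‖v‖. Working with angles keeps the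
constant 1, where the chord bound would lose π/2. -/
lemma GeoLip.abs_fderiv_radialExt_le {f : UnitSphere n → ℝ} (hf : GeoLip 1 f) (x : UnitSphere n)
    {v : EuclideanSpace ℝ (Fin n)} (hv : ⟪(x : EuclideanSpace ℝ (Fin n)), v⟫ = 0) :
    |fderiv ℝ (radialExt f) x v| ≤ ‖v‖ := by
  by_cases h : DifferentiableAt ℝ (radialExt f) x
  swap
  · simp [fderiv_zero_of_not_differentiableAt h]
  have h1 : HasDerivAt (fun s : ℝ => radialExt f ((x : EuclideanSpace ℝ (Fin n)) + s • v))
      (fderiv ℝ (radialExt f) x v) 0 := h.hasFDerivAt.hasLineDerivAt _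
  refine h1.le_of_lip' (norm_nonneg _) (Eventually.of_forall fun s => ?_)
  have hin : ⟪(x : EuclideanSpace ℝ (Fin n)), s • v⟫ = 0 := by rw [inner_smul_right, hv, mul_zero]
  have hne : (x : EuclideanSpace ℝ (Fin n)) + s • v ≠ 0 := by
    intro h0
    have : ⟪(x : EuclideanSpace ℝ (Fin n)), x + s • v⟫ = 1 := by
      rw [inner_add_right, inner_self, hin, add_zero]
    rw [h0, inner_zero_right] at this
    exact zero_ne_one this
  rw [zero_smul, add_zero, sub_zero, Real.norm_eq_abs, abs_sub_comm]
  refine (hf.abs_radialExt_sub_le (coe_ne_zero x) hne).trans ?_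
  rw [InnerProductGeometry.angle_add_eq_arctan_of_inner_eq_zero hin (coe_ne_zero x), norm_coe,
    div_one, norm_smul, mul_comm]
  have h2 : 0 ≤ Real.arctan (‖v‖ * ‖s‖) := Real.arctan_nonneg.2 (by positivity)
  simpa using Real.le_tan h2 (Real.arctan_lt_pi_div_two _)

/-- Rademacher's theorem on the sphere. -/
lemma GeoLip.exists_gradient {f : UnitSphere n → ℝ} (hf : GeoLip 1 f) :
    ∃ a : UnitSphere n → EuclideanSpace ℝ (Fin n), Measurable a ∧ (∀ x, ‖a x‖ ≤ 1) ∧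
      (∀ x : UnitSphere n, ⟪a x, x⟫ = 0) ∧
      ∀ᵐ x ∂(sphereUniform n), (fun y : UnitSphere n => f y - f x - ⟪a x, y - x⟫) =o[𝓝 x]
        fun y => (y : EuclideanSpace ℝ (Fin n)) - x := by
  have hinner : ∀ (x : UnitSphere n) (v : EuclideanSpace ℝ (Fin n)),
      ⟪(InnerProductSpace.toDual ℝ _).symm (fderiv ℝ (radialExt f) x), v⟫ =
        fderiv ℝ (radialExt f) x v := fun x v => InnerProductSpace.toDual_symm_apply
  have htan : ∀ x : UnitSphere n,
      ⟪(InnerProductSpace.toDual ℝ _).symm (fderiv ℝ (radialExt f) x), x⟫ = 0 := fun x => by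
    rw [hinner, fderiv_radialExt_self]
  refine ⟨fun x => (InnerProductSpace.toDual ℝ _).symm (fderiv ℝ (radialExt f) x), ?_, ?_, htan,
    ?_⟩
  · exact (LinearIsometryEquiv.continuous _).measurable.comp
      ((measurable_fderiv ℝ (radialExt f)).comp measurable_subtype_coe)
  · intro x
    -- Testing on the gradient itself gives ‖a‖² ≤ ‖a‖.
    have h1 := hf.abs_fderiv_radialExt_le x (by rw [real_inner_comm, htan])
    rw [← hinner, real_inner_self_eq_norm_sq, abs_of_nonneg (by positivity), pow_two] at h1
    by_contra! h2
    nlinarith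
  · filter_upwards [hf.ae_differentiableAt_radialExt] with x hx
    have h1 := hx.hasFDerivAt.isLittleO
    have h2 := h1.comp_tendsto (continuous_subtype_val.tendsto x)
    refine h2.congr (fun y => ?_) fun y => rfl
    simp only [Function.comp_apply, radialExt_coe, hinner]

/-- The covariance inequality between a Lipschitz function and an increasing function of it. -/
lemma GeoLip.covariance_comp_le (hn : 3 ≤ n) {f : UnitSphere n → ℝ} (hf : GeoLip 1 f)
    {T τ : ℝ → ℝ} (hT : ∀ s, HasDerivAt T (τ s) s) (hτ : Continuous τ) (hτ0 : ∀ s, 0 ≤ τ s)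
    {M : ℝ} (hM : ∀ s, τ s ≤ M) :
    ∫ x, f x * T (f x) ∂(sphereUniform n) -
        (∫ x, f x ∂(sphereUniform n)) * ∫ x, T (f x) ∂(sphereUniform n) ≤
      1 / (n - 2) * ∫ x, τ (f x) ∂(sphereUniform n) := by
  obtain ⟨a, ha, ha1, hax, hdiff⟩ := hf.exists_gradient
  have hfc := hf.continuous
  have hM0 : 0 ≤ M := (hτ0 0).trans (hM 0)
  have hTlip : ∀ s t, |T s - T t| ≤ M * |s - t| := fun s t => by
    have := Convex.norm_image_sub_le_of_norm_hasDerivWithin_le (f := T) (f' := τ) (C := M)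
      (s := univ) (x := t) (y := s) (fun u _ => (hT u).hasDerivWithinAt)
      (fun u _ => by rw [Real.norm_eq_abs, abs_of_nonneg (hτ0 u)]; exact hM u)
      convex_univ trivial trivial
    simpa using this
  have hg : GeoLip M (fun x => T (f x)) := fun x y => by
    refine (hTlip _ _).trans ?_
    gcongr
    simpa using hf x y
  -- Chain rule: the gradient of T ∘ f is τ(f) times that of f.
  have h := hf.covariance_le hn hg (a := fun x => τ (f x) • a x)
    ((hτ.comp hfc).measurable.smul ha) (B := M) (fun x => ?_) (fun x => ?_) ?_
  · refine h.trans ?_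
    have hn2 : (0 : ℝ) < n - 2 := by
      have : (3 : ℝ) ≤ n := by exact_mod_cast hn
      linarith
    refine mul_le_mul_of_nonneg_left ?_ (by positivity)
    refine integral_mono ?_ (integrable_of_continuous (hτ.comp hfc)) fun x => ?_
    · refine Integrable.of_bound
        (((hτ.comp hfc).measurable.smul ha).norm).aestronglyMeasurable M (ae_of_all _ fun x => ?_)
      rw [norm_norm, norm_smul, Real.norm_eq_abs]
      simp only [abs_of_nonneg (hτ0 _)]
      nlinarith [hτ0 (f x), hM (f x), ha1 x, norm_nonneg (a x)]
    · simp only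
      rw [norm_smul, Real.norm_eq_abs, abs_of_nonneg (hτ0 _)]
      exact mul_le_of_le_one_right (hτ0 _) (ha1 x)
  · rw [norm_smul, Real.norm_eq_abs, abs_of_nonneg (hτ0 _)]
    nlinarith [hτ0 (f x), hM (f x), ha1 x, norm_nonneg (a x)]
  · rw [inner_smul_left, hax, mul_zero]
  · filter_upwards [hdiff] with x hx
    have h1 : (fun y : UnitSphere n => T (f y) - T (f x) - (f y - f x) • τ (f x)) =o[𝓝 x]
        fun y => f y - f x :=
      (hasDerivAt_iff_isLittleO.1 (hT (f x))).comp_tendsto (hfc.tendsto x)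
    have h2 : (fun y : UnitSphere n => f y - f x) =O[𝓝 x]
        fun y => (y : EuclideanSpace ℝ (Fin n)) - x :=
      Asymptotics.IsBigO.of_bound (Real.pi / 2) (Eventually.of_forall fun y => by
        rw [Real.norm_eq_abs]
        refine (hf y x).trans ?_
        rw [one_mul]
        exact geodesicDist_le_pi_half_mul y x)
    refine ((h1.trans_isBigO h2).add (hx.const_mul_left (τ (f x)))).congr_left fun y => ?_
    rw [inner_smul_left, smul_eq_mul]
    simp only [conj_trivial]
    ring

/-! ### The deviation inequality -/

/-- The derivative of the test function: the derivative of `exp (l s² / 2) / l` for positive `s`,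
cut off between `r - δ` and `r`. -/
noncomputable def testDeriv (l r δ s : ℝ) : ℝ :=
  max s 0 * Real.exp (l * s ^ 2 / 2) * min 1 (max 0 ((r - s) / δ))

lemma continuous_testDeriv (l r δ : ℝ) : Continuous (testDeriv l r δ) := by
  unfold testDeriv
  fun_prop

lemma testDeriv_nonneg (l r δ s : ℝ) : 0 ≤ testDeriv l r δ s := by
  unfold testDeriv
  have : 0 ≤ max s 0 := le_max_right _ _
  positivity

lemma testDeriv_of_nonpos {l r δ s : ℝ} (hs : s ≤ 0) : testDeriv l r δ s = 0 := by
  simp [testDeriv, hs]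

lemma testDeriv_le_indicator {l r δ : ℝ} (hδ : 0 < δ) (s : ℝ) :
    testDeriv l r δ s ≤
      (Iio r).indicator (fun s => max s 0 * Real.exp (l * s ^ 2 / 2)) s := by
  have h0 : 0 ≤ max s 0 := le_max_right _ _
  by_cases hs : s < r
  · rw [indicator_of_mem (mem_Iio.2 hs), testDeriv]
    exact mul_le_of_le_one_right (by positivity) (min_le_left _ _)
  · rw [indicator_of_notMem (by simpa using hs), testDeriv,
      max_eq_left (div_nonpos_of_nonpos_of_nonneg (by linarith) hδ.le)]
    simp

lemma testDeriv_le {l r δ : ℝ} (hl : 0 ≤ l) (hr : 0 < r) (hδ : 0 < δ) (s : ℝ) :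
    testDeriv l r δ s ≤ r * Real.exp (l * r ^ 2 / 2) := by
  rcases le_or_gt s 0 with h | h
  · rw [testDeriv_of_nonpos h]
    positivity
  refine (testDeriv_le_indicator hδ s).trans ?_
  by_cases hs : s < r
  · rw [indicator_of_mem (mem_Iio.2 hs), max_eq_left h.le]
    gcongr
  · rw [indicator_of_notMem (by simpa using hs)]
    positivity

lemma testDeriv_of_le {l r δ s : ℝ} (hδ : 0 < δ) (hs0 : 0 ≤ s) (hs : s ≤ r - δ) :
    testDeriv l r δ s = s * Real.exp (l * s ^ 2 / 2) := by
  have : 1 ≤ (r - s) / δ := by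
    rw [one_le_div hδ]
    linarith
  rw [testDeriv, max_eq_left hs0, max_eq_right (zero_le_one.trans this), min_eq_left this, mul_one]

lemma integral_testDeriv_of_le {l r δ s : ℝ} (hl : 0 < l) (hδ : 0 < δ) (hs0 : 0 ≤ s)
    (hs : s ≤ r - δ) :
    ∫ t in (0 : ℝ)..s, testDeriv l r δ t = (Real.exp (l * s ^ 2 / 2) - 1) / l := by
  have h1 : ∫ t in (0 : ℝ)..s, testDeriv l r δ t =
      ∫ t in (0 : ℝ)..s, t * Real.exp (l * t ^ 2 / 2) := by
    refine intervalIntegral.integral_congr fun t ht => ?_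
    rw [uIcc_of_le hs0] at ht
    exact testDeriv_of_le hδ ht.1 (ht.2.trans hs)
  rw [h1, intervalIntegral.integral_eq_sub_of_hasDerivAt
    (f := fun t => Real.exp (l * t ^ 2 / 2) / l)]
  · simp
    ring
  · intro t _
    have h2 : HasDerivAt (fun t : ℝ => l * t ^ 2 / 2) (l * t) t := by
      refine (((hasDerivAt_pow 2 t).const_mul l).div_const 2).congr_deriv ?_
      push_cast
      ring
    refine (h2.exp.div_const l).congr_deriv ?_
    field_simp
  · exact Continuous.intervalIntegrable (by fun_prop) _ _

/-- The primitive is explicit up to r - δ, and what it gains beyond that is nonnegative and dropped.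
-/
lemma le_mul_integral_testDeriv {l r δ : ℝ} (hl : 0 < l) (hδ : 0 < δ) (hδr : δ < r) (s : ℝ) :
    max s 0 * (Real.exp (l * min (max s 0) (r - δ) ^ 2 / 2) - 1) ≤
      l * (s * ∫ t in (0 : ℝ)..s, testDeriv l r δ t) := by
  rcases le_or_gt s 0 with h | h
  · have : ∫ t in (0 : ℝ)..s, testDeriv l r δ t = 0 := by
      rw [intervalIntegral.integral_symm, neg_eq_zero]
      rw [intervalIntegral.integral_congr (g := fun _ => 0) fun t ht => ?_]
      · simp
      · rw [uIcc_of_le h] at ht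
        exact testDeriv_of_nonpos ht.2
    rw [this, max_eq_right h]
    simp
  · rw [max_eq_left h.le]
    have h1 : 0 ≤ min s (r - δ) := le_min h.le (by linarith)
    have h2 := integral_testDeriv_of_le (r := r) hl hδ h1 (min_le_right _ _)
    have h3 : ∫ t in (0 : ℝ)..min s (r - δ), testDeriv l r δ t ≤
        ∫ t in (0 : ℝ)..s, testDeriv l r δ t :=
      intervalIntegral.integral_mono_interval le_rfl h1 (min_le_left _ _)
        (ae_of_all _ fun t => testDeriv_nonneg l r δ t)
        ((continuous_testDeriv l r δ).intervalIntegrable _ _)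
    rw [h2, div_le_iff₀ hl] at h3
    calc _ ≤ s * ((∫ t in (0 : ℝ)..s, testDeriv l r δ t) * l) := by gcongr
      _ = _ := by ring

/-- The inequality obtained from the covariance inequality with the truncated Gaussian weight. -/
lemma GeoLip.integral_mul_exp_min_le (hn : 3 ≤ n) {f : UnitSphere n → ℝ} (hf : GeoLip 1 f)
    (hf0 : ∫ x, f x ∂(sphereUniform n) = 0) {r : ℝ} (hr : 0 < r) :
    ∫ x, max (f x) 0 * Real.exp (((n : ℝ) - 2) * min (max (f x) 0) r ^ 2 / 2)
        ∂(sphereUniform n) ≤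
      ∫ x, max (f x) 0 ∂(sphereUniform n) +
        ∫ x, (Iio r).indicator (fun s => max s 0 * Real.exp (((n : ℝ) - 2) * s ^ 2 / 2)) (f x)
          ∂(sphereUniform n) := by
  have hl : (0 : ℝ) < n - 2 := by
    have : (3 : ℝ) ≤ n := by exact_mod_cast hn
    linarith
  set l : ℝ := (n : ℝ) - 2 with hldef
  have hfc := hf.continuous
  set A := ∫ x, max (f x) 0 * Real.exp (l * min (max (f x) 0) r ^ 2 / 2) ∂(sphereUniform n)
  set P := ∫ x, max (f x) 0 ∂(sphereUniform n) with hP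
  set I := ∫ x, (Iio r).indicator (fun s => max s 0 * Real.exp (l * s ^ 2 / 2)) (f x)
          ∂(sphereUniform n) with hI
  have hiI : Integrable (fun x => (Iio r).indicator
      (fun s => max s 0 * Real.exp (l * s ^ 2 / 2)) (f x)) (sphereUniform n) :=
    (integrable_of_continuous (F := fun x => max (f x) 0 * Real.exp (l * f x ^ 2 / 2))
      (by fun_prop)).indicator (hfc.measurable measurableSet_Iio)
  -- The exponential factor pays for replacing the cutoff r - δ by r in the exponent; it tends to 1
  -- as δ → 0.
  have key : ∀ δ, 0 < δ → δ < r → Real.exp (-(l * (r ^ 2 - (r - δ) ^ 2) / 2)) * A ≤ P + I := by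
    intro δ hδ hδr
    have hτc := continuous_testDeriv l r δ
    have hTd : ∀ s, HasDerivAt (fun s => ∫ t in (0 : ℝ)..s, testDeriv l r δ t)
        (testDeriv l r δ s) s := fun s =>
      intervalIntegral.integral_hasDerivAt_right (hτc.intervalIntegrable _ _)
        (hτc.stronglyMeasurableAtFilter _ _) hτc.continuousAt
    have hTc : Continuous fun s => ∫ t in (0 : ℝ)..s, testDeriv l r δ t :=
      continuous_iff_continuousAt.2 fun s => (hTd s).continuousAt
    have hcov := hf.covariance_comp_le hn hTd hτc (testDeriv_nonneg l r δ)
      (testDeriv_le hl.le hr hδ)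
    rw [hf0, zero_mul, sub_zero, ← hldef, one_div, ← div_eq_inv_mul, le_div_iff₀' hl,
      ← integral_const_mul] at hcov
    have h1 : ∫ x, testDeriv l r δ (f x) ∂(sphereUniform n) ≤ I :=
      integral_mono (integrable_of_continuous (by fun_prop)) hiI
        fun x => testDeriv_le_indicator hδ (f x)
    have h2 : ∫ x, max (f x) 0 * (Real.exp (l * min (max (f x) 0) (r - δ) ^ 2 / 2) - 1)
        ∂(sphereUniform n) ≤
        ∫ x, l * (f x * ∫ t in (0 : ℝ)..f x, testDeriv l r δ t) ∂(sphereUniform n) :=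
      integral_mono (integrable_of_continuous (by fun_prop))
        (integrable_of_continuous (continuous_const.mul (hfc.mul (hTc.comp hfc))))
        fun x => le_mul_integral_testDeriv hl hδ hδr (f x)
    have h3 : Real.exp (-(l * (r ^ 2 - (r - δ) ^ 2) / 2)) * A ≤
        ∫ x, max (f x) 0 * Real.exp (l * min (max (f x) 0) (r - δ) ^ 2 / 2)
          ∂(sphereUniform n) := by
      rw [← integral_const_mul]
      refine integral_mono (integrable_of_continuous (by fun_prop))
        (integrable_of_continuous (by fun_prop)) fun x => ?_
      simp only
      have hp : 0 ≤ max (f x) 0 := le_max_right _ _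
      set p := max (f x) 0
      rw [mul_left_comm, ← Real.exp_add]
      gcongr
      have : min p r ^ 2 - min p (r - δ) ^ 2 ≤ r ^ 2 - (r - δ) ^ 2 := by
        rcases le_total p (r - δ) with h | h
        · rw [min_eq_left h, min_eq_left (by linarith)]
          nlinarith
        · rw [min_eq_right h]
          have : min p r ^ 2 ≤ r ^ 2 := by
            gcongr
            exact min_le_right _ _
          linarith
      nlinarith
    have h4 : ∫ x, max (f x) 0 * (Real.exp (l * min (max (f x) 0) (r - δ) ^ 2 / 2) - 1)
        ∂(sphereUniform n) =
        ∫ x, max (f x) 0 * Real.exp (l * min (max (f x) 0) (r - δ) ^ 2 / 2)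
          ∂(sphereUniform n) - P := by
      rw [hP, ← integral_sub (integrable_of_continuous (by fun_prop))
        (integrable_of_continuous (by fun_prop))]
      congr 1
      ext x
      ring
    linarith
  have hlim : Tendsto (fun δ : ℝ => Real.exp (-(l * (r ^ 2 - (r - δ) ^ 2) / 2)) * A) (𝓝[>] 0)
      (𝓝 (Real.exp (-(l * (r ^ 2 - (r - 0) ^ 2) / 2)) * A)) :=
    ((by fun_prop : Continuous fun δ : ℝ =>
      Real.exp (-(l * (r ^ 2 - (r - δ) ^ 2) / 2)) * A).tendsto 0).mono_left nhdsWithin_le_nhds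
  simp only [sub_zero, sub_self, mul_zero, zero_div, neg_zero, Real.exp_zero, one_mul] at hlim
  refine le_of_tendsto hlim ?_
  filter_upwards [Ioo_mem_nhdsGT hr] with δ hδ
  exact key δ hδ.1 hδ.2

/-- One-sided deviation inequality for centered Lipschitz functions. -/
lemma GeoLip.mul_measureReal_le (hn : 3 ≤ n) {f : UnitSphere n → ℝ} (hf : GeoLip 1 f)
    (hf0 : ∫ x, f x ∂(sphereUniform n) = 0) {r : ℝ} (hr : 0 < r) :
    r * (sphereUniform n).real {x | r ≤ f x} ≤
      Real.exp (-((n : ℝ) - 2) * r ^ 2 / 2) * ∫ x, max (f x) 0 ∂(sphereUniform n) := by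
  have hfc := hf.continuous
  have hmain := hf.integral_mul_exp_min_le hn hf0 hr
  have hmeas : MeasurableSet {x | r ≤ f x} := measurableSet_le measurable_const hfc.measurable
  have hiI : Integrable (fun x => (Iio r).indicator
      (fun s => max s 0 * Real.exp (((n : ℝ) - 2) * s ^ 2 / 2)) (f x)) (sphereUniform n) :=
    (integrable_of_continuous (F := fun x => max (f x) 0 *
      Real.exp (((n : ℝ) - 2) * f x ^ 2 / 2)) (by fun_prop)).indicator
      (hfc.measurable measurableSet_Iio)
  -- Where f < r the two integrands cancel; where f ≥ r the second vanishes and the first is at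
  -- least r exp((n-2) r²/2).
  have hlow : ∫ x, {x | r ≤ f x}.indicator
        (fun _ => r * Real.exp (((n : ℝ) - 2) * r ^ 2 / 2)) x ∂(sphereUniform n) ≤
      ∫ x, max (f x) 0 * Real.exp (((n : ℝ) - 2) * min (max (f x) 0) r ^ 2 / 2)
        ∂(sphereUniform n) -
      ∫ x, (Iio r).indicator (fun s => max s 0 * Real.exp (((n : ℝ) - 2) * s ^ 2 / 2)) (f x)
          ∂(sphereUniform n) := by
    rw [← integral_sub (integrable_of_continuous (by fun_prop)) hiI]
    refine integral_mono ((integrable_const _).indicator hmeas)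
      ((integrable_of_continuous (by fun_prop)).sub hiI) fun x => ?_
    simp only
    by_cases h : r ≤ f x
    · rw [indicator_of_mem (show x ∈ {x | r ≤ f x} from h),
        indicator_of_notMem (by simpa using h), max_eq_left (hr.le.trans h), min_eq_right h, sub_zero]
      gcongr
    · have h' : f x < r := not_le.1 h
      rw [indicator_of_notMem (show x ∉ {x | r ≤ f x} from h), indicator_of_mem (mem_Iio.2 h'),
        min_eq_left (max_le h'.le hr.le)]
      rcases le_total (f x) 0 with h0 | h0
      · simp [h0]
      · rw [max_eq_left h0, sub_self]
  rw [integral_indicator_const _ hmeas, smul_eq_mul] at hlow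
  have hexp : Real.exp (-((n : ℝ) - 2) * r ^ 2 / 2) * Real.exp (((n : ℝ) - 2) * r ^ 2 / 2) = 1 := by
    rw [← Real.exp_add, ← Real.exp_zero]
    congr 1
    ring
  calc r * (sphereUniform n).real {x | r ≤ f x} =
        Real.exp (-((n : ℝ) - 2) * r ^ 2 / 2) * ((sphereUniform n).real {x | r ≤ f x} *
          (r * Real.exp (((n : ℝ) - 2) * r ^ 2 / 2))) := by
        linear_combination (-(r * (sphereUniform n).real {x | r ≤ f x})) * hexp
    _ ≤ _ := by
        gcongr
        linarith

end SphereConcentration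

/-! ### The two-sided inequality -/

open SphereConcentration in
theorem theorem1p3 (n : ℕ) (hn : 2 ≤ n) (f : UnitSphere n → ℝ)
    (hf : ∀ x y : UnitSphere n, |f x - f y| ≤ geodesicDist x y)
    (m : ℝ) (hm : m = ∫ x, f x ∂(sphereUniform n))
    (r : ℝ) (hr : 0 < r) :
    (sphereUniform n).real {x | r ≤ |f x - m|} ≤
      (1 / r) * Real.exp (-((n : ℝ) - 2) * r ^ 2 / 2) *
        ∫ x, |f x - m| ∂(sphereUniform n) := by
  have : NeZero n := ⟨by omega⟩
  have hfL : GeoLip 1 f := fun x y => by simpa using hf x y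
  have hfc := hfL.continuous
  rw [mul_assoc, one_div, inv_mul_eq_div, le_div_iff₀' hr]
  rcases hn.eq_or_lt with rfl | hn3
  -- For n = 2 the exponent is zero and Markov's inequality suffices.
  · have := mul_meas_ge_le_integral_of_nonneg (μ := sphereUniform 2) (f := fun x => |f x - m|)
      (ae_of_all _ fun x => abs_nonneg _) (integrable_of_continuous (by fun_prop)) r
    simpa using this
  have hp : GeoLip 1 (fun x => f x - m) := fun x y => by simpa using hf x y
  have hq : GeoLip 1 (fun x => m - f x) := fun x y => by
    rw [abs_sub_comm]
    simpa using hf x y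
  have hp0 : ∫ x, (f x - m) ∂(sphereUniform n) = 0 := by
    rw [integral_sub (integrable_of_continuous hfc) (integrable_const _), ← hm]
    simp
  have hq0 : ∫ x, (m - f x) ∂(sphereUniform n) = 0 := by
    rw [integral_sub (integrable_const _) (integrable_of_continuous hfc), ← hm]
    simp
  have hset : {x | r ≤ |f x - m|} = {x | r ≤ f x - m} ∪ {x | r ≤ m - f x} := by
    ext x
    simp [le_abs]
  -- The two one-sided bounds involve the positive and negative parts, which sum to |f - m|; hence
  -- no factor 2 is lost.
  have hint : ∫ x, |f x - m| ∂(sphereUniform n) = ∫ x, max (f x - m) 0 ∂(sphereUniform n) +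
      ∫ x, max (m - f x) 0 ∂(sphereUniform n) := by
    rw [← integral_add (integrable_of_continuous (by fun_prop))
      (integrable_of_continuous (by fun_prop))]
    congr 1
    ext x
    rcases le_total (f x) m with h | h
    · rw [abs_of_nonpos (by linarith), max_eq_right (by linarith), max_eq_left (by linarith)]
      ring
    · rw [abs_of_nonneg (by linarith), max_eq_left (by linarith), max_eq_right (by linarith)]
      ring
  have h1 := hp.mul_measureReal_le hn3 hp0 hr
  have h2 := hq.mul_measureReal_le hn3 hq0 hr
  calc r * (sphereUniform n).real {x | r ≤ |f x - m|} ≤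
        r * ((sphereUniform n).real {x | r ≤ f x - m} +
          (sphereUniform n).real {x | r ≤ m - f x}) := by
        rw [hset]
        gcongr
        exact measureReal_union_le _ _
    _ ≤ _ := by
        rw [hint]
        linarith
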